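/- **Setting.** Let $P=\mathbb{Z}\lambda_1\oplus\mathbb{Z}\lambda_2$ be the co-weight lattice of the root system $A_2$, where $\{\lambda_1,\lambda_2\}$ is the basis dual to the simple roots $\{\alpha_1,\alpha_2\}$, let $\alpha_0=\alpha_1+\alpha_2$, and let $\Sigma$ be the $\tilde A_2$ Coxeter complex, with vertex set $P$ and its three vertex types. Let $\mathscr{X}$ be a triangle building ($\tilde A_2$ building): a simplicial complex each of whose vertices has one of three types, whose apartments are all its subcomplexes type-isomorphic to $\Sigma$, such that any two simplexes lie in a common apartment and, for any two apartments $\mathscr{A},\mathscr{A}'$ with a chamber in common, there is a type-preserving isomorphism $\mathscr{A}\to\mathscr{A}'$ fixing $\mathscr{A}\cap\mathscr{A}'$ pointwise. Assume that $\mathscr{X}$ is locally finite with parameter $q<\infty$, i.e. every edge lies in precisely $q+1$ chambers. Let $\Omega$ be the set of equivalence classes of sectors of $\mathscr{X}$, two sectors being equivalent if they contain a common subsector. Two points $\omega,\omega'\in\Omega$ are opposite if exactly one apartment contains sectors representing both; this apartment is denoted $[\omega,\omega']$. Fix $\omega_0\in\Omega$, a vertex $O$ of the same type as the origin of $\Sigma$,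 an apartment $\mathscr{A}_0$ containing the sector $[O,\omega_0]$ with base vertex $O$ that represents $\omega_0$, and the type-preserving isomorphism $\psi:\mathscr{A}_0\to\Sigma$ that takes $[O,\omega_0]$ to $-\mathcal{S}_0$, where $\mathcal{S}_0$ is the fundamental sector with base vertex $0$ spanned by $\lambda_1$ and $\lambda_2$. Let $\rho:\mathscr{X}\to\Sigma$ be $\psi$ composed with the retraction of $\mathscr{X}$ onto $\mathscr{A}_0$ centred at $\omega_0$. Let $\Omega_0\subset\Omega$ be the set of the points opposite to $\omega_0$, and for a vertex $x$ let $E_x=\{\omega\in\Omega_0 : x\in[\omega,\omega_0]\}$. For $\lambda\in P$ let $\mathcal{F}_\lambda$ be the $\sigma$-field generated by the sets $E_x$ with $\rho(x)=\lambda$, let $\mathcal{F}=\sigma\big(\bigcup_{\lambda\in P}\mathcal{F}_\lambda\big)$, and let $\pi$ be the unique measure on $(\Omega_0,\mathcal{F})$ with $\pi(E_x)=q^{-2\langle\lambda,\alpha_0\rangle}$ whenever $\rho(x)=\lambda$. The $\sigma$-fields are completed by the $\pi$-null sets. Write $\mathbb{E}[f\,|\,\mathcal{F}_\lambda]$ for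 the conditional expectation (the Radon--Nikodym derivative with respect to $\mathcal{F}_\lambda$), and $f_\lambda=\mathbb{E}[f\,|\,\mathcal{F}_\lambda]$. **Proposition.** Let $f\in L^2(\Omega_0)$ (real- or complex-valued) and $\lambda\in P$. If $j\ge 0$ is an integer such that $f_{\lambda-j\lambda_1}=0$, then for every integer $k\ge j$ $$\big\lVert \mathbb{E}[f_\lambda\,|\,\mathcal{F}_{\lambda-k(\lambda_1-\lambda_2)}]\big\rVert_{L^2}\le 2\,q^{-(k-j+1)/2}\,\lVert f_\lambda\rVert_{L^2}.$$ Likewise, if $f_{\lambda-j\lambda_2}=0$, then for every integer $k\ge j$ $$\big\lVert \mathbb{E}[f_\lambda\,|\,\mathcal{F}_{\lambda-k(\lambda_2-\lambda_1)}]\big\rVert_{L^2}\le 2\,q^{-(k-j+1)/2}\,\lVert f_\lambda\rVert_{L^2}.$$ -/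

import Mathlib

open MeasureTheory
open scoped ENNReal

namespace TriangleBuilding

/-! ### The `A₂` Coxeter complex -/

/-- The co-weight lattice `P`; the pair `(i, j)` stands for `i λ₁ + j λ₂`, so that
`⟨(i, j), α₁⟩ = i`, `⟨(i, j), α₂⟩ = j` and `⟨(i, j), α₀⟩ = i + j`.
It is also the vertex set of the Coxeter complex. -/
abbrev Coweight : Type := ℤ × ℤ

/-- The fundamental co-weight `λ₁`. -/
def lam1 : Coweight := (1, 0)

/-- The fundamental co-weight `λ₂`. -/
def lam2 : Coweight := (0, 1)

/-- The level `⟨μ, α₀⟩`. -/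
def level (μ : Coweight) : ℤ := μ.1 + μ.2

/-- The type of a vertex of the Coxeter complex: its class modulo the co-root lattice spanned by
`α₁ = 2 λ₁ - λ₂` and `α₂ = 2 λ₂ - λ₁`. The vertices `0, λ₁, λ₂` have types `0, 1, 2`. -/
def coxeterType (μ : Coweight) : ZMod 3 := ((μ.1 - μ.2 : ℤ) : ZMod 3)

/-- The Coxeter complex `Σ`. The walls `⟨x, α⟩ = k` cut the plane into triangles, whose vertex
sets are `{μ, μ + λ₁, μ + λ₂}` and `{μ, μ - λ₁, μ - λ₂}` for `μ ∈ P`; the simplexes are the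
non-empty subsets of these. -/
def coxeterComplex : AbstractSimplicialComplex Coweight where
  faces := {s | s.Nonempty ∧ ∃ μ : Coweight,
    s ⊆ {μ, μ + lam1, μ + lam2} ∨ s ⊆ {μ, μ - lam1, μ - lam2}}
  isRelLowerSet_faces := fun _ hs => ⟨hs.1, fun _ hts ht => ⟨ht, by
    obtain ⟨μ, h | h⟩ := hs.2
    · exact ⟨μ, Or.inl (hts.trans h)⟩
    · exact ⟨μ, Or.inr (hts.trans h)⟩⟩⟩
  singleton_mem := fun μ => ⟨Finset.singleton_nonempty μ, μ, Or.inl (by simp)⟩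

/-- The reflection `r₁` in the wall `⟨x, α₁⟩ = 0`, that is, `x ↦ x - ⟨x, α₁⟩ α₁`. -/
def refl1 : Equiv.Perm Coweight where
  toFun μ := (-μ.1, μ.1 + μ.2)
  invFun μ := (-μ.1, μ.1 + μ.2)
  left_inv μ := by ext <;> simp
  right_inv μ := by ext <;> simp

/-- The reflection `r₂` in the wall `⟨x, α₂⟩ = 0`, that is, `x ↦ x - ⟨x, α₂⟩ α₂`. -/
def refl2 : Equiv.Perm Coweight where
  toFun μ := (μ.1 + μ.2, -μ.2)
  invFun μ := (μ.1 + μ.2, -μ.2)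
  left_inv μ := by ext <;> simp
  right_inv μ := by ext <;> simp

/-- The finite Weyl group `W₀`, acting on `P`. -/
def finiteWeylGroup : Subgroup (Equiv.Perm Coweight) := Subgroup.closure {refl1, refl2}

/-- The vertices of the (closed) fundamental sector. -/
def fundamentalSector : Set Coweight := {μ | 0 ≤ μ.1 ∧ 0 ≤ μ.2}

/-- The vertices of the (closed) sector with base vertex `μ` and direction `w`. -/
def coxeterSector (μ : Coweight) (w : Equiv.Perm Coweight) : Set Coweight :=
  (fun ν => μ + w ν) '' fundamentalSector

/-! ### Triangle buildings -/

/-- A simplicial complex with vertex set `V` each of whose vertices has one of three types. -/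
structure TypedComplex (V : Type*) where
  cplx : AbstractSimplicialComplex V
  typ : V → ZMod 3

variable {V : Type*}

/-- A type-preserving isomorphism from the Coxeter complex onto a subcomplex of `X`. -/
structure Chart (X : TypedComplex V) where
  emb : Coweight ↪ V
  typ_emb : ∀ μ, X.typ (emb μ) = coxeterType μ
  map_mem : ∀ s ∈ coxeterComplex.faces, s.map emb ∈ X.cplx.faces

/-- The simplexes of the image of the subcomplex of `Σ` that consists of the simplexes with
vertices in `U`. -/
def Chart.onSet {X : TypedComplex V} (φ : Chart X) (U : Set Coweight) : Set (Finset V) :=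
  {t | ∃ s ∈ coxeterComplex.faces, (∀ μ ∈ s, μ ∈ U) ∧ t = s.map φ.emb}

/-- The simplexes of the image of `Σ`. -/
def Chart.image {X : TypedComplex V} (φ : Chart X) : Set (Finset V) := φ.onSet Set.univ

/-- The apartments of the complete apartment system: all the subcomplexes that are
type-isomorphic to `Σ`. -/
def IsApartment (X : TypedComplex V) (A : Set (Finset V)) : Prop :=
  ∃ φ : Chart X, A = φ.image

/-- `X`, with all the subcomplexes type-isomorphic to `Σ` as its apartments, is a triangle
building. In the second axiom `φ` and `φ'` parametrize two apartments with a chamber in common,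
and the isomorphism between these that fixes their intersection is `φ'' ∘ φ⁻¹`. -/
structure IsTriangleBuilding (X : TypedComplex V) : Prop where
  exists_apartment : ∀ s ∈ X.cplx.faces, ∀ t ∈ X.cplx.faces,
    ∃ A, IsApartment X A ∧ s ∈ A ∧ t ∈ A
  exists_iso : ∀ φ φ' : Chart X,
    (∃ C : Finset V, C.card = 3 ∧ C ∈ φ.image ∧ C ∈ φ'.image) →
    ∃ φ'' : Chart X, φ''.image = φ'.image ∧
      ∀ μ : Coweight, {φ.emb μ} ∈ φ'.image → φ''.emb μ = φ.emb μ

/-- `X` is locally finite with parameter `q`: each edge lies in precisely `q + 1` chambers. -/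
def HasParameter (X : TypedComplex V) (q : ℕ) : Prop :=
  ∀ e ∈ X.cplx.faces, e.card = 2 →
    {C : Finset V | C ∈ X.cplx.faces ∧ C.card = 3 ∧ e ⊆ C}.encard = (q : ℕ∞) + 1

/-- Sectors, as sets of simplexes. -/
def IsSector (X : TypedComplex V) (S : Set (Finset V)) : Prop :=
  ∃ φ : Chart X, ∃ μ : Coweight, ∃ w ∈ finiteWeylGroup, S = φ.onSet (coxeterSector μ w)

/-- Two sectors are equivalent if they contain a common subsector. -/
def SectorEquiv (X : TypedComplex V) (S S' : Set (Finset V)) : Prop :=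
  ∃ T, IsSector X T ∧ T ⊆ S ∧ T ⊆ S'

/-- The boundary `Ω`: the equivalence classes of sectors. -/
def Boundary (X : TypedComplex V) : Type _ :=
  {ω : Set (Set (Finset V)) //
    ∃ S, IsSector X S ∧ ω = {S' | IsSector X S' ∧ SectorEquiv X S S'}}

/-- The apartment `A` contains sectors that represent `ω` and `ω'`. -/
def Joins {X : TypedComplex V} (A : Set (Finset V)) (ω ω' : Boundary X) : Prop :=
  IsApartment X A ∧ (∃ S ∈ ω.1, S ⊆ A) ∧ (∃ S ∈ ω'.1, S ⊆ A)

/-- `ω` and `ω'` are opposite: only one apartment contains sectors representing both. -/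
def Opposite {X : TypedComplex V} (ω ω' : Boundary X) : Prop := ∃! A, Joins A ω ω'

/-- The apartment `[ω, ω']` of two opposite boundary points. -/
noncomputable def spannedApartment {X : TypedComplex V} {ω ω' : Boundary X}
    (h : Opposite ω ω') : Set (Finset V) := h.exists.choose

/-! ### The set `Ω₀`, its filtration and its measure -/

/-- The choices made once and for all: a boundary point `ω₀`, an origin `O`, and an apartment
containing the sector `[O, ω₀]`, identified with `Σ` by a type-preserving isomorphism `ψ` that takes
this sector to the opposite of the fundamental sector. The field `chart` is the inverse of `ψ`. -/
structure Frame (X : TypedComplex V) where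
  origin : V
  omega : Boundary X
  chart : Chart X
  chart_zero : chart.emb 0 = origin
  sector_mem : chart.onSet {μ | μ.1 ≤ 0 ∧ μ.2 ≤ 0} ∈ omega.1

variable {X : TypedComplex V}

/-- `ρ(x) = μ`, where `ρ` is the retraction from `ω₀` onto the chosen apartment, composed with `ψ`:
some apartment contains `x` as well as a subsector of the chosen sector, and the isomorphism
from this apartment to the chosen one that fixes the subsector, followed by `ψ`, takes
`x` to `μ`. The chart `φ` below is the inverse of this composition. -/
def RetractsTo (b : Frame X) (x : V) (μ : Coweight) : Prop :=
  ∃ φ : Chart X, φ.emb μ = x ∧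
    ∃ ν : Coweight, ∀ κ : Coweight, κ.1 ≤ ν.1 → κ.2 ≤ ν.2 → φ.emb κ = b.chart.emb κ

/-- The set `Ω₀` of the boundary points opposite to `ω₀`. -/
def Omega0 (b : Frame X) : Type _ := {ω : Boundary X // Opposite ω b.omega}

/-- The set `E_x` of those `ω ∈ Ω₀` for which `x` belongs to the apartment `[ω, ω₀]`. -/
def E (b : Frame X) (x : V) : Set (Omega0 b) := {ω | {x} ∈ spannedApartment ω.2}

/-- The σ-field `F_μ` generated by the sets `E_x` with `ρ(x) = μ`. -/
@[reducible] def Fil (b : Frame X) (μ : Coweight) : MeasurableSpace (Omega0 b) :=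
  MeasurableSpace.generateFrom {s | ∃ x, RetractsTo b x μ ∧ s = E b x}

/-- The σ-field `F` on `Ω₀` generated by all the `F_μ`. -/
instance instMeasurableSpaceOmega0 (b : Frame X) : MeasurableSpace (Omega0 b) := ⨆ μ, Fil b μ

theorem Fil_le (b : Frame X) (μ : Coweight) : Fil b μ ≤ instMeasurableSpaceOmega0 b :=
  le_iSup (Fil b) μ

/-- `m` is the measure `π` on `(Ω₀, F)`, which is the only one with
`π(E_x) = q ^ (-2 ⟨μ, α₀⟩)` whenever `ρ(x) = μ`. -/
def IsBoundaryMeasure (b : Frame X) (q : ℕ) (m : Measure (Omega0 b)) : Prop :=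
  ∀ (μ : Coweight) (x : V), RetractsTo b x μ → m (E b x) = (q : ℝ≥0∞) ^ (-2 * level μ)

/-- The conditional expectation `𝔼[f | F_μ]` of `f ∈ L²(Ω₀)`, again as an element of `L²(Ω₀)`.
As `π` is infinite in general, a function in `L²` need not be integrable, so that
Mathlib's `condExp` would be a junk value here; `condExpL2` has no such restriction. -/
noncomputable def condE {𝕜 : Type*} [RCLike 𝕜] (b : Frame X) (m : Measure (Omega0 b))
    (μ : Coweight) (f : Lp 𝕜 2 m) : Lp 𝕜 2 m :=
  (condExpL2 𝕜 𝕜 (Fil_le b μ) f : Lp 𝕜 2 m)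

/-- `condE b m μ f` is measurable with respect to `F_μ`, completed by the null sets. -/
theorem aestronglyMeasurable_condE {𝕜 : Type*} [RCLike 𝕜] (b : Frame X) (m : Measure (Omega0 b))
    (μ : Coweight) (f : Lp 𝕜 2 m) : AEStronglyMeasurable[Fil b μ] (condE b m μ f) m :=
  aestronglyMeasurable_condExpL2 (Fil_le b μ) f

/-- `condE b m μ f` is the Radon–Nikodym derivative of `f dπ` with respect to `F_μ`. -/
theorem setIntegral_condE {𝕜 : Type*} [RCLike 𝕜] (b : Frame X) (m : Measure (Omega0 b))
    (μ : Coweight) (f : Lp 𝕜 2 m) (s : Set (Omega0 b)) (hs : MeasurableSet[Fil b μ] s)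
    (hms : m s ≠ ∞) : ∫ ω in s, condE b m μ f ω ∂m = ∫ ω in s, f ω ∂m :=
  integral_condExpL2_eq (E' := 𝕜) (𝕜 := 𝕜) (Fil_le b μ) f hs hms

end TriangleBuilding

open TriangleBuilding

/-! A point ω opposite to ω₀ is encoded by the vertices `Y i j ω` of [ω, ω₀] that ρ sends to iλ₁ +
jλ₂. The sets E_x over iλ₁ + jλ₂ are then the fibres of `Y i j`, and conditional expectation is
averaging over these fibres. The analysis uses only the properties collected in `HoroSystem`; these
are symmetric in the two coordinates, so one half of the proposition gives the other.

Geometry. A retraction argument (`AgreeOn.opp`) shows that apartments towards ω₀ which share two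
vertices share their hull. Combined with at most q continuations across each panel and the
prescribed masses of the E_x, this gives the exact mass of an intersection of two fibres
(`HoroSystem.measure_cell`). Comparing masses yields a conditional independence,
`HoroSystem.proj_proj_eq`: in the configurations needed, with b in the hull of a and c, the
expectation at c of an F_a-measurable function can be taken through F_b.

One edge. Let f be measurable at μ + λ₁ with zero expectation at μ. On each atom at μ, passing to μ
+ λ₂ is q⁻¹ times the incidence operator between the q² points off a line of a projective plane of
order q (the link of the vertex) and the q² lines that avoid a fixed point of this line. On
functions of sum zero this operator has norm at most √q (`sum_norm_sum_sq_le`), so each edge costs a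
factor q^(-1/2). The vanishing condition is inherited along λ₂ - λ₁, so s edges give q^(-s/2)
(`HoroSystem.norm_proj_sq_le`).

Summation. If the expectation at λ - jλ₁ vanishes, f_λ is the orthogonal sum of the differences
between λ - lλ₁ and λ - (l+1)λ₁ for l < j. The l-th has k - l edges to walk, and the remaining lλ₂
costs nothing. Cauchy–Schwarz leaves q^(-(k-j+1)) times a geometric sum, which is at most 4 if q ≥
2; for q = 1 contractivity is enough. -/

namespace TriangleBuilding

/-! ### Hexagonal geometry of the Coxeter complex -/

/-- The hexagonal distance of `u` and `v` is at most `n`. -/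
def HexLe (u v : Coweight) (n : ℤ) : Prop :=
  (-n ≤ v.1 - u.1 ∧ v.1 - u.1 ≤ n) ∧ (-n ≤ v.2 - u.2 ∧ v.2 - u.2 ≤ n) ∧
    (-n ≤ v.1 + v.2 - (u.1 + u.2) ∧ v.1 + v.2 - (u.1 + u.2) ≤ n)

/-- Two vertices of the Coxeter complex are equal or joined by an edge. -/
abbrev Adj (u v : Coweight) : Prop := HexLe u v 1

theorem HexLe.symm {u v : Coweight} {n : ℤ} (h : HexLe u v n) : HexLe v u n := by
  unfold HexLe at *; omega

theorem HexLe.trans {u v w : Coweight} {n k : ℤ} (h : HexLe u v n) (h' : HexLe v w k) :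
    HexLe u w (n + k) := by
  unfold HexLe at *; omega

theorem eq_of_hexLe_zero {u v : Coweight} (h : HexLe u v 0) : u = v := by
  unfold HexLe at h; ext <;> omega

theorem exists_adj_of_hexLe_succ {u v : Coweight} {n : ℤ} (hn : 0 ≤ n) (h : HexLe u v (n + 1)) :
    ∃ c, Adj u c ∧ HexLe c v n := by
  obtain ⟨a, b⟩ := u
  obtain ⟨c, d⟩ := v
  simp only [HexLe] at h
  rcases lt_trichotomy a c with h1 | h1 | h1 <;> rcases lt_trichotomy b d with h2 | h2 | h2
  · exact ⟨(a + 1, b), by simp only [HexLe]; omega, by simp only [HexLe]; omega⟩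
  · exact ⟨(a + 1, b), by simp only [HexLe]; omega, by simp only [HexLe]; omega⟩
  · exact ⟨(a + 1, b - 1), by simp only [HexLe]; omega, by simp only [HexLe]; omega⟩
  · exact ⟨(a, b + 1), by simp only [HexLe]; omega, by simp only [HexLe]; omega⟩
  · exact ⟨(a, b), by simp only [HexLe]; omega, by simp only [HexLe]; omega⟩
  · exact ⟨(a, b - 1), by simp only [HexLe]; omega, by simp only [HexLe]; omega⟩
  · exact ⟨(a - 1, b + 1), by simp only [HexLe]; omega, by simp only [HexLe]; omega⟩
  · exact ⟨(a - 1, b), by simp only [HexLe]; omega, by simp only [HexLe]; omega⟩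
  · exact ⟨(a - 1, b), by simp only [HexLe]; omega, by simp only [HexLe]; omega⟩

/-- A map that preserves adjacency does not increase the hexagonal distance. -/
theorem HexLe.map {g : Coweight → Coweight} (hg : ∀ u v, Adj u v → Adj (g u) (g v)) (n : ℕ) :
    ∀ u v, HexLe u v n → HexLe (g u) (g v) n := by
  induction n with
  | zero =>
    intro u v h
    obtain rfl : u = v := eq_of_hexLe_zero (by simpa using h)
    simp only [HexLe]; omega
  | succ n ih =>
    intro u v h
    obtain ⟨c, h1, h2⟩ := exists_adj_of_hexLe_succ (n := n) (by omega) (by simpa using h)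
    have := (hg u c h1).trans (ih c v h2)
    rwa [add_comm (1 : ℤ) n] at this

theorem adj_of_mem_face {s : Finset Coweight} (hs : s ∈ coxeterComplex.faces) {u v : Coweight}
    (hu : u ∈ s) (hv : v ∈ s) : Adj u v := by
  obtain ⟨_, μ, h | h⟩ := hs
  all_goals
    have h1 := h hu
    have h2 := h hv
    simp only [Finset.mem_insert, Finset.mem_singleton] at h1 h2
    obtain ⟨a, b⟩ := u
    obtain ⟨c, d⟩ := v
    obtain ⟨x, y⟩ := μ
    simp only [lam1, lam2, Prod.mk_add_mk, Prod.mk_sub_mk, Prod.mk.injEq] at h1 h2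
    simp only [HexLe]
    omega

/-- The three distinct vertices `u`, `v`, `w` form a chamber. -/
structure Tri (u v w : Coweight) : Prop where
  adj1 : Adj u v
  adj2 : Adj v w
  adj3 : Adj u w
  ne1 : u ≠ v
  ne2 : v ≠ w
  ne3 : u ≠ w

theorem eq_of_adj {u v : Coweight} (h : Adj u v) (hne : u ≠ v) :
    v = (u.1 + 1, u.2) ∨ v = (u.1, u.2 + 1) ∨ v = (u.1 - 1, u.2 + 1) ∨ v = (u.1 - 1, u.2) ∨
      v = (u.1, u.2 - 1) ∨ v = (u.1 + 1, u.2 - 1) := by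
  obtain ⟨a, b⟩ := u
  obtain ⟨c, d⟩ := v
  simp only [HexLe] at h
  simp only [ne_eq, Prod.mk.injEq] at *
  omega

theorem Tri.rotate {u v w : Coweight} (h : Tri u v w) : Tri v w u :=
  ⟨h.adj2, h.adj3.symm, h.adj1.symm, h.ne2, h.ne3.symm, h.ne1.symm⟩

theorem Tri.swap {u v w : Coweight} (h : Tri u v w) : Tri v u w :=
  ⟨h.adj1.symm, h.adj3, h.adj2, h.ne1.symm, h.ne3, h.ne2⟩

/-- In an apartment a panel lies in exactly two chambers, which are mirror images in it; the six
directions of the edge are checked separately. -/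
theorem Tri.third {u v w c : Coweight} (h : Tri u v w) (hu : Adj u c) (hv : Adj v c)
    (hcu : c ≠ u) (hcv : c ≠ v) : c = w ∨ c = u + v - w := by
  have h2 := h.adj2
  have h3 := h.adj3
  have n2 := h.ne2
  have n3 := h.ne3
  rcases eq_of_adj h.adj1 h.ne1 with e | e | e | e | e | e <;>
  · subst e
    obtain ⟨a, b⟩ := u
    obtain ⟨c, d⟩ := c
    obtain ⟨x, y⟩ := w
    simp only [HexLe] at hu hv h2 h3
    simp only [ne_eq, Prod.mk.injEq, Prod.mk_add_mk, Prod.mk_sub_mk] at *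
    omega

theorem Tri.opp {u v w : Coweight} (h : Tri u v w) : Tri u v (u + v - w) := by
  have h1 := h.adj1
  have h2 := h.adj2
  have h3 := h.adj3
  have n2 := h.ne2
  have n3 := h.ne3
  have n1 := h.ne1
  obtain ⟨a, b⟩ := u
  obtain ⟨c, d⟩ := v
  obtain ⟨x, y⟩ := w
  simp only [HexLe] at h1 h2 h3
  simp only [ne_eq, Prod.mk.injEq] at n1 n2 n3
  constructor <;> simp only [HexLe, ne_eq, Prod.mk.injEq, Prod.mk_add_mk, Prod.mk_sub_mk] <;> omega

theorem Tri.opp_ne {u v w : Coweight} (h : Tri u v w) : u + v - w ≠ w := by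
  have h1 := h.adj1
  have h2 := h.adj2
  have h3 := h.adj3
  have n2 := h.ne2
  have n3 := h.ne3
  have n1 := h.ne1
  obtain ⟨a, b⟩ := u
  obtain ⟨c, d⟩ := v
  obtain ⟨x, y⟩ := w
  simp only [HexLe] at h1 h2 h3
  simp only [ne_eq, Prod.mk.injEq, Prod.mk_add_mk, Prod.mk_sub_mk] at *
  omega

theorem mem_faces_up (μ : Coweight) {s : Finset Coweight} (hne : s.Nonempty)
    (h : s ⊆ {μ, μ + lam1, μ + lam2}) : s ∈ coxeterComplex.faces := ⟨hne, μ, Or.inl h⟩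

theorem mem_faces_down (μ : Coweight) {s : Finset Coweight} (hne : s.Nonempty)
    (h : s ⊆ {μ, μ - lam1, μ - lam2}) : s ∈ coxeterComplex.faces := ⟨hne, μ, Or.inr h⟩

theorem Tri.mem_faces {u v w : Coweight} (h : Tri u v w) :
    ({u, v, w} : Finset Coweight) ∈ coxeterComplex.faces := by
  have hne : ({u, v, w} : Finset Coweight).Nonempty := ⟨u, by simp⟩
  have key : ∀ c : Coweight, (∀ x ∈ ({u, v, w} : Finset Coweight),
      x = c ∨ x = c + lam1 ∨ x = c + lam2) ∨ (∀ x ∈ ({u, v, w} : Finset Coweight),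
      x = c ∨ x = c - lam1 ∨ x = c - lam2) →
      ({u, v, w} : Finset Coweight) ∈ coxeterComplex.faces := by
    rintro c (h | h)
    · exact mem_faces_up c hne fun x hx => by simpa using h x hx
    · exact mem_faces_down c hne fun x hx => by simpa using h x hx
  have h2 := h.adj2
  have h3 := h.adj3
  have n2 := h.ne2
  have n3 := h.ne3
  have h1 := h.adj1
  have n1 := h.ne1
  clear h hne
  obtain ⟨a, b⟩ := u
  obtain ⟨x, y⟩ := v
  obtain ⟨z, t⟩ := w
  simp only [Finset.mem_insert, Finset.mem_singleton, forall_eq_or_imp, forall_eq, lam1, lam2,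
    Prod.forall, Prod.mk.injEq, Prod.mk_add_mk, Prod.mk_sub_mk] at key
  simp only [HexLe] at h1 h2 h3
  simp only [ne_eq, Prod.mk.injEq] at n1 n2 n3
  -- The levels of an upward triangle are s, s + 1, s + 1, with total 3 max - 1; those of a downward
  -- one are s, s - 1, s - 1, with total 3 max - 2. The corner is the coordinatewise minimum or
  -- maximum.
  by_cases hs : a + b + x + y + z + t = 3 * (max (a + b) (max (x + y) (z + t))) - 1
  · refine key (min a (min x z)) (min b (min y t)) (Or.inl ?_)
    omega
  · refine key (max a (max x z)) (max b (max y t)) (Or.inr ?_)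
    omega

theorem mem_faces_of_adj {u v : Coweight} (h : Adj u v) :
    ({u, v} : Finset Coweight) ∈ coxeterComplex.faces := by
  have hne : ({u, v} : Finset Coweight).Nonempty := ⟨u, by simp⟩
  by_cases e : u = v
  · subst e
    exact mem_faces_up u hne fun x hx => by simp_all
  have key : ∃ w, Tri u v w := by
    rcases eq_of_adj h e with h | h | h | h | h | h
    · exact ⟨(u.1, u.2 + 1), by constructor <;> simp only [h, HexLe, ne_eq, Prod.ext_iff] <;> omega⟩
    · exact ⟨(u.1 + 1, u.2), by constructor <;> simp only [h, HexLe, ne_eq, Prod.ext_iff] <;> omega⟩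
    · exact ⟨(u.1, u.2 + 1), by constructor <;> simp only [h, HexLe, ne_eq, Prod.ext_iff] <;> omega⟩
    · exact ⟨(u.1, u.2 - 1), by constructor <;> simp only [h, HexLe, ne_eq, Prod.ext_iff] <;> omega⟩
    · exact ⟨(u.1 - 1, u.2), by constructor <;> simp only [h, HexLe, ne_eq, Prod.ext_iff] <;> omega⟩
    · exact ⟨(u.1, u.2 - 1), by constructor <;> simp only [h, HexLe, ne_eq, Prod.ext_iff] <;> omega⟩
  obtain ⟨w, hw⟩ := key
  exact coxeterComplex.isRelLowerSet_faces.mem_of_le (b := ({u, v} : Finset Coweight))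
    hw.mem_faces (fun x hx => by
      simp only [Finset.mem_insert, Finset.mem_singleton] at hx ⊢; tauto) hne

theorem Tri.add_smul (i j : ℤ) : Tri (i, j) (i + 1, j) (i, j + 1) := by
  constructor <;> simp only [HexLe, ne_eq, Prod.ext_iff] <;> omega

theorem Tri.sub_smul (i j : ℤ) : Tri (i, j) (i - 1, j) (i, j - 1) := by
  constructor <;> simp only [HexLe, ne_eq, Prod.ext_iff] <;> omega

/-- A property of vertices that spreads across panels and holds on a chamber holds everywhere. -/
theorem forall_of_tri {p : Coweight → Prop}
    (hp : ∀ u v w, Tri u v w → p u → p v → p w → p (u + v - w))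
    {u v w : Coweight} (h : Tri u v w) (hu : p u) (hv : p v) (hw : p w) (μ : Coweight) : p μ := by
  -- `U i j` concerns the upward chamber based at (i, j). Each unit translate of it along an axis is
  -- reached by crossing two panels, so `U` spreads along rows and columns.
  let U : ℤ → ℤ → Prop := fun i j => p (i, j) ∧ p (i + 1, j) ∧ p (i, j + 1)
  have hU : ∀ i j, U i j → p (i + 1, j + 1) := fun i j ⟨h1, h2, h3⟩ => by
    have := hp _ _ _ (Tri.add_smul i j).rotate h2 h3 h1
    convert this using 1
    ext <;> simp
  have h1 : ∀ i j, U i j → U (i + 1) j := fun i j hij => by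
    have h4 := hU i j hij
    obtain ⟨h1, h2, h3⟩ := hij
    refine ⟨h2, ?_, h4⟩
    have ht : Tri (i + 1, j) (i + 1, j + 1) (i, j + 1) := by
      constructor <;> simp only [HexLe, ne_eq, Prod.ext_iff] <;> omega
    have := hp _ _ _ ht h2 h4 h3
    convert this using 1
    ext <;> simp
    ring
  have h2 : ∀ i j, U i j → U i (j + 1) := fun i j hij => by
    have h4 := hU i j hij
    obtain ⟨h1, h2, h3⟩ := hij
    refine ⟨h3, h4, ?_⟩
    have ht : Tri (i, j + 1) (i + 1, j + 1) (i + 1, j) := by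
      constructor <;> simp only [HexLe, ne_eq, Prod.ext_iff] <;> omega
    have := hp _ _ _ ht h3 h4 h2
    convert this using 1
    ext <;> simp
    ring
  have h3 : ∀ i j, U i j → U (i - 1) j := fun i j ⟨h1, h2, h3⟩ => by
    have h4 : p (i - 1, j + 1) := by
      have := hp _ _ _ (Tri.add_smul i j).rotate.rotate h3 h1 h2
      convert this using 1
      ext <;> simp
    refine ⟨?_, by simpa using h1, h4⟩
    have ht : Tri (i - 1, j + 1) (i, j) (i, j + 1) := by
      constructor <;> simp only [HexLe, ne_eq, Prod.ext_iff] <;> omega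
    have := hp _ _ _ ht h4 h1 h3
    convert this using 1
    ext <;> simp
  have h4 : ∀ i j, U i j → U i (j - 1) := fun i j ⟨h1, h2, h3⟩ => by
    have h4 : p (i + 1, j - 1) := by
      have := hp _ _ _ (Tri.add_smul i j) h1 h2 h3
      convert this using 1
      ext <;> simp
    refine ⟨?_, h4, by simpa using h1⟩
    have ht : Tri (i + 1, j - 1) (i, j) (i + 1, j) := by
      constructor <;> simp only [HexLe, ne_eq, Prod.ext_iff] <;> omega
    have := hp _ _ _ ht h4 h1 h2
    convert this using 1
    ext <;> simp
  have row : ∀ i j, U i j → ∀ k, U k j := fun i j hij k =>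
    Int.inductionOn' (motive := fun k => U k j) k i hij (fun k _ hk => h1 k j hk)
      (fun k _ hk => h3 k j hk)
  have col : ∀ i j, U i j → ∀ k, U i k := fun i j hij k =>
    Int.inductionOn' (motive := fun k => U i k) k j hij (fun k _ hk => h2 i k hk)
      (fun k _ hk => h4 i k hk)
  have all : ∀ i j, U i j → ∀ μ, p μ := fun i j hij μ => (col _ _ (row i j hij μ.1) μ.2).1
  have start : ∃ i j, U i j := by
    have hmem := h.mem_faces
    have hcard : ({u, v, w} : Finset Coweight).card = 3 :=
      Finset.card_eq_three.2 ⟨u, v, w, h.ne1, h.ne3, h.ne2, rfl⟩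
    have hall : ∀ x ∈ ({u, v, w} : Finset Coweight), p x := by
      simp only [Finset.mem_insert, Finset.mem_singleton]
      rintro x (rfl | rfl | rfl) <;> assumption
    obtain ⟨_, c, hc | hc⟩ := hmem
    · have e := Finset.eq_of_subset_of_card_le hc (by rw [hcard]; exact Finset.card_le_three)
      rw [e] at hall
      obtain ⟨i, j⟩ := c
      refine ⟨i, j, hall _ (by simp), hall _ (by simp [lam1]), hall _ (by simp [lam2])⟩
    · have e := Finset.eq_of_subset_of_card_le hc (by rw [hcard]; exact Finset.card_le_three)
      rw [e] at hall
      obtain ⟨i, j⟩ := c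
      have a1 : p (i, j) := hall _ (by simp)
      have a2 : p (i - 1, j) := hall _ (by simp [lam1])
      have a3 : p (i, j - 1) := hall _ (by simp [lam2])
      refine ⟨i - 1, j - 1, ?_, by simpa using a3, by simpa using a2⟩
      have := hp _ _ _ (Tri.sub_smul i j).rotate a2 a3 a1
      convert this using 1
      ext <;> simp
  obtain ⟨i, j, hij⟩ := start
  exact all i j hij μ

end TriangleBuilding

namespace TriangleBuilding

variable {V : Type*} {X : TypedComplex V}

/-! ### Charts of a triangle building -/

theorem Chart.mem_image {φ : Chart X} {t : Finset V} :
    t ∈ φ.image ↔ ∃ s ∈ coxeterComplex.faces, t = s.map φ.emb := by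
  simp [Chart.image, Chart.onSet]

theorem Chart.map_mem_image (φ : Chart X) {s : Finset Coweight} (hs : s ∈ coxeterComplex.faces) :
    s.map φ.emb ∈ φ.image := Chart.mem_image.2 ⟨s, hs, rfl⟩

theorem Chart.singleton_mem_image {φ : Chart X} {x : V} :
    {x} ∈ φ.image ↔ ∃ μ, φ.emb μ = x := by
  rw [Chart.mem_image]
  constructor
  · rintro ⟨s, -, h⟩
    have hx : x ∈ s.map φ.emb := h ▸ Finset.mem_singleton_self x
    obtain ⟨μ, -, h⟩ := Finset.mem_map.1 hx
    exact ⟨μ, h⟩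
  · rintro ⟨μ, rfl⟩
    exact ⟨{μ}, coxeterComplex.singleton_mem μ, by simp⟩

theorem Chart.adj_of_mem_image {φ : Chart X} {t : Finset V} (ht : t ∈ φ.image) {u v : Coweight}
    (hu : φ.emb u ∈ t) (hv : φ.emb v ∈ t) : Adj u v := by
  obtain ⟨s, hs, rfl⟩ := Chart.mem_image.1 ht
  exact adj_of_mem_face hs (by simpa using hu) (by simpa using hv)

theorem Chart.exists_of_mem_image {φ : Chart X} {t : Finset V} (ht : t ∈ φ.image) {x : V}
    (hx : x ∈ t) : ∃ μ, φ.emb μ = x := by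
  obtain ⟨s, hs, rfl⟩ := Chart.mem_image.1 ht
  obtain ⟨μ, -, h⟩ := Finset.mem_map.1 hx
  exact ⟨μ, h⟩

theorem Chart.mem_onSet {φ : Chart X} {U : Set Coweight} {t : Finset V} :
    t ∈ φ.onSet U ↔ t ∈ φ.image ∧ ∀ x ∈ t, x ∈ φ.emb '' U := by
  rw [Chart.mem_image]
  constructor
  · rintro ⟨s, hs, hU, rfl⟩
    refine ⟨⟨s, hs, rfl⟩, fun x hx => ?_⟩
    obtain ⟨μ, hμ, rfl⟩ := Finset.mem_map.1 hx
    exact ⟨μ, hU μ hμ, rfl⟩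
  · rintro ⟨⟨s, hs, rfl⟩, h⟩
    refine ⟨s, hs, fun μ hμ => ?_, rfl⟩
    obtain ⟨ν, hν, e⟩ := h (φ.emb μ) (Finset.mem_map_of_mem _ hμ)
    rwa [← φ.emb.injective e]

theorem Chart.singleton_mem_onSet {φ : Chart X} {U : Set Coweight} {μ : Coweight} :
    {φ.emb μ} ∈ φ.onSet U ↔ μ ∈ U := by
  rw [Chart.mem_onSet]
  refine ⟨fun h => ?_, fun h => ⟨Chart.singleton_mem_image.2 ⟨μ, rfl⟩, by
    rintro x hx
    rw [Finset.mem_singleton.1 hx]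
    exact ⟨μ, h, rfl⟩⟩⟩
  obtain ⟨ν, hν, e⟩ := h.2 _ (Finset.mem_singleton_self _)
  rwa [← φ.emb.injective e]

theorem Chart.onSet_mono (φ : Chart X) {U U' : Set Coweight} (h : U ⊆ U') :
    φ.onSet U ⊆ φ.onSet U' := fun _ ⟨s, hs, hU, e⟩ => ⟨s, hs, fun μ hμ => h (hU μ hμ), e⟩

theorem Chart.onSet_subset_image (φ : Chart X) (U : Set Coweight) : φ.onSet U ⊆ φ.image :=
  φ.onSet_mono (Set.subset_univ U)

theorem Chart.image_subset_faces (φ : Chart X) : φ.image ⊆ X.cplx.faces := fun _ ht => by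
  obtain ⟨s, hs, rfl⟩ := Chart.mem_image.1 ht
  exact φ.map_mem s hs

/-- Two charts agree on a chamber. -/
structure AgreeOn (φ ψ : Chart X) (u v w : Coweight) : Prop where
  tri : Tri u v w
  eq1 : φ.emb u = ψ.emb u
  eq2 : φ.emb v = ψ.emb v
  eq3 : φ.emb w = ψ.emb w

theorem AgreeOn.symm {φ ψ : Chart X} {u v w : Coweight} (h : AgreeOn φ ψ u v w) :
    AgreeOn ψ φ u v w := ⟨h.tri, h.eq1.symm, h.eq2.symm, h.eq3.symm⟩

theorem AgreeOn.trans {φ ψ χ : Chart X} {u v w : Coweight} (h : AgreeOn φ ψ u v w)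
    (h' : AgreeOn ψ χ u v w) : AgreeOn φ χ u v w :=
  ⟨h.tri, h.eq1.trans h'.eq1, h.eq2.trans h'.eq2, h.eq3.trans h'.eq3⟩

/-- The chamber of a chart on three mutually adjacent vertices. -/
theorem Tri.map_mem_image {u v w : Coweight} (h : Tri u v w) (φ : Chart X) :
    ({u, v, w} : Finset Coweight).map φ.emb ∈ φ.image := φ.map_mem_image h.mem_faces

theorem Tri.card_map {u v w : Coweight} (h : Tri u v w) (φ : Chart X) :
    (({u, v, w} : Finset Coweight).map φ.emb).card = 3 := by
  rw [Finset.card_map]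
  exact Finset.card_eq_three.2 ⟨u, v, w, h.ne1, h.ne3, h.ne2, rfl⟩

/-- If the chamber of `φ` on the panel `{u, v}` opposite to `w` belongs to `ψ.image`, the third
vertex is the image under `ψ` of `w` or of its mirror image. -/
theorem Tri.chart_third {φ ψ : Chart X} {u v w c : Coweight} (h : Tri u v w)
    (h1 : φ.emb u = ψ.emb u) (h2 : φ.emb v = ψ.emb v) (hc : Tri u v c) {t : Finset V} (hu : φ.emb u ∈ t) (hv : φ.emb v ∈ t) (hw : φ.emb c ∈ t)
    (ht : t ∈ ψ.image) : ∃ d, ψ.emb d = φ.emb c ∧ (d = w ∨ d = u + v - w) := by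
  obtain ⟨d, hd⟩ := Chart.exists_of_mem_image ht hw
  refine ⟨d, hd, h.third ?_ ?_ ?_ ?_⟩
  · exact Chart.adj_of_mem_image ht (h1 ▸ hu) (hd ▸ hw)
  · exact Chart.adj_of_mem_image ht (h2 ▸ hv) (hd ▸ hw)
  · rintro rfl
    exact hc.ne3 (φ.emb.injective (h1.trans hd))
  · rintro rfl
    exact hc.ne2 (φ.emb.injective (h2.trans hd))

/-- Rigidity: across a panel on which the charts agree there are two candidates for the next vertex,
and injectivity excludes folding back. -/
theorem AgreeOn.emb_eq_of_image_subset {φ ψ : Chart X} {u v w : Coweight} (h : AgreeOn φ ψ u v w)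
    (him : φ.image ⊆ ψ.image) (μ : Coweight) : φ.emb μ = ψ.emb μ := by
  refine forall_of_tri (p := fun μ => φ.emb μ = ψ.emb μ) ?_ h.tri h.eq1 h.eq2 h.eq3 μ
  intro u v w ht h1 h2 h3
  obtain ⟨d, hd, rfl | rfl⟩ := ht.chart_third h1 h2 ht.opp (by simp) (by simp) (by simp)
    (him (ht.opp.map_mem_image φ))
  · rw [← h3] at hd
    exact absurd (φ.emb.injective hd) ht.opp_ne.symm
  · exact hd.symm

/-- A vertex of two apartments has the same coordinates in charts of these that agree on a
chamber. -/
theorem AgreeOn.emb_eq (hX : IsTriangleBuilding X) {φ ψ : Chart X} {u v w : Coweight}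
    (h : AgreeOn φ ψ u v w) {μ ν : Coweight} (hμ : φ.emb μ = ψ.emb ν) : φ.emb μ = ψ.emb μ := by
  have himg : ∀ {a}, φ.emb a = ψ.emb a → {φ.emb a} ∈ ψ.image := fun {a} e =>
    Chart.singleton_mem_image.2 ⟨a, e.symm⟩
  have hC : ({u, v, w} : Finset Coweight).map φ.emb = ({u, v, w} : Finset Coweight).map ψ.emb := by
    ext x
    simp [h.eq1, h.eq2, h.eq3]
  -- χ reparametrizes the apartment of ψ and coincides with φ on the intersection. It agrees with ψ
  -- on the chamber, so χ = ψ by rigidity.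
  obtain ⟨χ, hχ, hχ'⟩ := hX.exists_iso φ ψ ⟨_, h.tri.card_map φ, h.tri.map_mem_image φ,
    hC ▸ h.tri.map_mem_image ψ⟩
  have h1 : AgreeOn χ ψ u v w := ⟨h.tri, (hχ' _ (himg h.eq1)).trans h.eq1,
    (hχ' _ (himg h.eq2)).trans h.eq2, (hχ' _ (himg h.eq3)).trans h.eq3⟩
  rw [← h1.emb_eq_of_image_subset hχ.le μ, hχ' μ (Chart.singleton_mem_image.2 ⟨ν, hμ.symm⟩)]

/-- Consequently the retraction onto an apartment centred at a chamber is well defined: coordinates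
do not depend on the auxiliary apartment. -/
theorem AgreeOn.eq_of_emb_eq (hX : IsTriangleBuilding X) {φ ψ : Chart X} {u v w : Coweight}
    (h : AgreeOn φ ψ u v w) {μ ν : Coweight} (hμ : φ.emb μ = ψ.emb ν) : μ = ν :=
  ψ.emb.injective ((h.emb_eq hX hμ).symm.trans hμ)

/-- Every simplex lies in an apartment with a chart that agrees with a given one on a chamber. -/
theorem exists_agreeOn (hX : IsTriangleBuilding X) (φ : Chart X) {u v w : Coweight}
    (h : Tri u v w) {t : Finset V} (ht : t ∈ X.cplx.faces) :
    ∃ ψ : Chart X, AgreeOn φ ψ u v w ∧ t ∈ ψ.image := by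
  obtain ⟨A, ⟨ψ, rfl⟩, h1, h2⟩ := hX.exists_apartment _
    (φ.image_subset_faces (h.map_mem_image φ)) _ ht
  obtain ⟨χ, hχ, hχ'⟩ := hX.exists_iso φ ψ ⟨_, h.card_map φ, h.map_mem_image φ, h1⟩
  have himg : ∀ a ∈ ({u, v, w} : Finset Coweight), φ.emb a = χ.emb a := fun a ha =>
    (hχ' a (Chart.singleton_mem_image.2
      (Chart.exists_of_mem_image h1 (Finset.mem_map_of_mem _ ha)))).symm
  exact ⟨χ, ⟨h, himg _ (by simp), himg _ (by simp), himg _ (by simp)⟩, hχ ▸ h2⟩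

/-- Convexity: if two charts agree on a chamber and at a vertex that is nearer to the mirror image
of this chamber in a panel, they agree on the mirror image. -/
theorem AgreeOn.opp (hX : IsTriangleBuilding X) {φ ψ : Chart X} {u v w : Coweight}
    (h : AgreeOn φ ψ u v w) {μ : Coweight} (hμ : φ.emb μ = ψ.emb μ) {n : ℕ}
    (h1 : HexLe (u + v - w) μ n) (h2 : ¬ HexLe w μ n) :
    φ.emb (u + v - w) = ψ.emb (u + v - w) := by
  -- Otherwise let `g` be φ followed by the retraction onto the apartment of ψ centred at the mirror
  -- chamber of ψ. It preserves adjacency, fixes μ and folds `u + v - w` onto `w`, so that `w` would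
  -- be within distance `n` of μ.
  by_contra hne
  have ho := h.tri.opp
  have ex : ∀ t ∈ X.cplx.faces, ∃ χ : Chart X, AgreeOn ψ χ u v (u + v - w) ∧ t ∈ χ.image :=
    fun t ht => exists_agreeOn hX ψ ho ht
  have uniq : ∀ {χ χ' : Chart X} {a b : Coweight}, AgreeOn ψ χ u v (u + v - w) →
      AgreeOn ψ χ' u v (u + v - w) → χ.emb a = χ'.emb b → a = b := fun h h' e =>
    (h.symm.trans h').eq_of_emb_eq hX e
  have ex' : ∀ κ, ∃ a, ∃ χ : Chart X, AgreeOn ψ χ u v (u + v - w) ∧ χ.emb a = φ.emb κ := fun κ => by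
    obtain ⟨χ, h1, h2⟩ := ex {φ.emb κ} (X.cplx.singleton_mem _)
    obtain ⟨a, ha⟩ := Chart.singleton_mem_image.1 h2
    exact ⟨a, χ, h1, ha⟩
  choose g χ hχ hg using ex'
  have refl : AgreeOn ψ ψ u v (u + v - w) := ⟨ho, rfl, rfl, rfl⟩
  have fix : ∀ κ, φ.emb κ = ψ.emb κ → g κ = κ := fun κ hκ =>
    uniq (hχ κ) refl ((hg κ).trans hκ)
  have hadj : ∀ a b, Adj a b → Adj (g a) (g b) := fun a b hab => by
    obtain ⟨ξ, h3, h4⟩ := ex _ (φ.image_subset_faces (φ.map_mem_image (mem_faces_of_adj hab)))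
    have ha : φ.emb a ∈ ({a, b} : Finset Coweight).map φ.emb := by simp
    have hb : φ.emb b ∈ ({a, b} : Finset Coweight).map φ.emb := by simp
    obtain ⟨a', ha'⟩ := Chart.exists_of_mem_image h4 ha
    obtain ⟨b', hb'⟩ := Chart.exists_of_mem_image h4 hb
    rw [uniq (hχ a) h3 ((hg a).trans ha'.symm), uniq (hχ b) h3 ((hg b).trans hb'.symm)]
    exact Chart.adj_of_mem_image h4 (ha' ▸ ha) (hb' ▸ hb)
  have hw : g (u + v - w) = w := by
    obtain ⟨ξ, h3, h4⟩ := ex _ (φ.image_subset_faces (ho.map_mem_image φ))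
    obtain ⟨d, hd, hd'⟩ := h.tri.chart_third (h.eq1.trans h3.eq1) (h.eq2.trans h3.eq2) ho
      (by simp) (by simp) (by simp) h4
    rw [uniq (hχ _) h3 ((hg _).trans hd.symm)]
    refine hd'.resolve_right ?_
    rintro rfl
    exact hne (hd.symm.trans h3.eq3.symm)
  have := HexLe.map hadj n _ _ h1
  rw [hw, fix μ hμ] at this
  exact h2 this

end TriangleBuilding

/-! ### Convexity across walls, panels and links -/

namespace TriangleBuilding

variable {V : Type*} {X : TypedComplex V}

/-- The hexagonal distance. -/
def hexDist (u v : Coweight) : ℕ :=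
  max (v.1 - u.1).natAbs (max (v.2 - u.2).natAbs (v.1 + v.2 - (u.1 + u.2)).natAbs)

theorem hexLe_hexDist (u v : Coweight) : HexLe u v (hexDist u v) := by
  unfold HexLe hexDist; omega

theorem not_hexLe_of_lt {u v : Coweight} {n : ℕ} (h : n < hexDist u v) : ¬ HexLe u v n := by
  unfold hexDist at h; unfold HexLe; omega

/-- The wall here is ⟨x, α₀⟩ = i + j. The mirror vertex is strictly nearer than the old third vertex
to anything beyond the wall, which is what `AgreeOn.opp` requires. The next two lemmas treat the
walls of α₁ and α₂. -/
theorem emb_eq_across_wall_zero (hX : IsTriangleBuilding X) {φ ψ : Chart X} {i j a b : ℤ}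
    (h1 : φ.emb (i, j) = ψ.emb (i, j)) (h2 : φ.emb (i + 1, j - 1) = ψ.emb (i + 1, j - 1))
    (h3 : φ.emb (i, j - 1) = ψ.emb (i, j - 1)) (hab : φ.emb (a, b) = ψ.emb (a, b))
    (h : i + j < a + b) : φ.emb (i + 1, j) = ψ.emb (i + 1, j) := by
  have e : ((i, j) : Coweight) + (i + 1, j - 1) - (i, j - 1) = (i + 1, j) := by
    ext <;> simp
  have ht : Tri (i, j) (i + 1, j - 1) (i, j - 1) := by
    constructor <;> simp only [HexLe, ne_eq, Prod.ext_iff] <;> omega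
  have := AgreeOn.opp hX ⟨ht, h1, h2, h3⟩ hab (hexLe_hexDist _ _)
    (not_hexLe_of_lt (by rw [e]; simp only [hexDist]; omega))
  rwa [e] at this

theorem emb_eq_across_wall_one (hX : IsTriangleBuilding X) {φ ψ : Chart X} {i j a b : ℤ}
    (h1 : φ.emb (i, j) = ψ.emb (i, j)) (h2 : φ.emb (i, j - 1) = ψ.emb (i, j - 1))
    (h3 : φ.emb (i - 1, j) = ψ.emb (i - 1, j)) (hab : φ.emb (a, b) = ψ.emb (a, b))
    (h : i < a) : φ.emb (i + 1, j - 1) = ψ.emb (i + 1, j - 1) := by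
  have e : ((i, j) : Coweight) + (i, j - 1) - (i - 1, j) = (i + 1, j - 1) := by
    ext <;> simp
  have ht : Tri (i, j) (i, j - 1) (i - 1, j) := by
    constructor <;> simp only [HexLe, ne_eq, Prod.ext_iff] <;> omega
  have := AgreeOn.opp hX ⟨ht, h1, h2, h3⟩ hab (hexLe_hexDist _ _)
    (not_hexLe_of_lt (by rw [e]; simp only [hexDist]; omega))
  rwa [e] at this

theorem emb_eq_across_wall_two (hX : IsTriangleBuilding X) {φ ψ : Chart X} {i j a b : ℤ}
    (h1 : φ.emb (i, j) = ψ.emb (i, j)) (h2 : φ.emb (i - 1, j) = ψ.emb (i - 1, j))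
    (h3 : φ.emb (i, j - 1) = ψ.emb (i, j - 1)) (hab : φ.emb (a, b) = ψ.emb (a, b))
    (h : j < b) : φ.emb (i - 1, j + 1) = ψ.emb (i - 1, j + 1) := by
  have e : ((i, j) : Coweight) + (i - 1, j) - (i, j - 1) = (i - 1, j + 1) := by
    ext <;> simp
  have ht : Tri (i, j) (i - 1, j) (i, j - 1) := by
    constructor <;> simp only [HexLe, ne_eq, Prod.ext_iff] <;> omega
  have := AgreeOn.opp hX ⟨ht, h1, h2, h3⟩ hab (hexLe_hexDist _ _)
    (not_hexLe_of_lt (by rw [e]; simp only [hexDist]; omega))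
  rwa [e] at this

/-- Charts that agree on a sector agree on each larger sector, with the same direction, to whose
base vertex they agree. -/
theorem emb_eq_of_le (hX : IsTriangleBuilding X) {φ ψ : Chart X} {n : ℤ}
    (hn : ∀ i j, i ≤ n → j ≤ n → φ.emb (i, j) = ψ.emb (i, j)) {a b : ℤ}
    (hab : φ.emb (a, b) = ψ.emb (a, b)) {i j : ℤ} (hi : i ≤ a) (hj : j ≤ b) :
    φ.emb (i, j) = ψ.emb (i, j) := by
  -- The quadrant of agreement grows by one column or row at a time. All of a new column except its
  -- top vertex comes from crossing a wall of α₁; the top vertex needs one more crossing, of a wall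
  -- of α₀. Rows are similar with α₂.
  let Q : ℤ → ℤ → Prop := fun s t => ∀ i j, i ≤ s → j ≤ t → φ.emb (i, j) = ψ.emb (i, j)
  obtain ⟨k, hk1, hk2, hk3⟩ : ∃ k, k ≤ n ∧ k ≤ a ∧ k ≤ b :=
    ⟨min n (min a b), by omega, by omega, by omega⟩
  have start : Q k k := fun i j h1 h2 => hn i j (by omega) (by omega)
  have right : ∀ s t, s < a → t ≤ b → Q s t → Q (s + 1) t := by
    intro s t hs ht h i j h1 h2
    rcases (show i ≤ s ∨ i = s + 1 by omega) with h3 | rfl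
    · exact h i j h3 h2
    rcases (show j < t ∨ j = t by omega) with h4 | rfl
    · have := emb_eq_across_wall_one hX (h s (j + 1) (by omega) (by omega))
        (h s (j + 1 - 1) (by omega) (by omega)) (h (s - 1) (j + 1) (by omega) (by omega)) hab hs
      simpa using this
    · have h5 := emb_eq_across_wall_one hX (h s j (by omega) (by omega))
        (h s (j - 1) (by omega) (by omega)) (h (s - 1) j (by omega) (by omega)) hab hs
      exact emb_eq_across_wall_zero hX (h s j (by omega) (by omega)) h5
        (h s (j - 1) (by omega) (by omega)) hab (by omega)
  have up : ∀ s t, s ≤ a → t < b → Q s t → Q s (t + 1) := by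
    intro s t hs ht h i j h1 h2
    rcases (show j ≤ t ∨ j = t + 1 by omega) with h3 | rfl
    · exact h i j h1 h3
    rcases (show i < s ∨ i = s by omega) with h4 | rfl
    · have := emb_eq_across_wall_two hX (h (i + 1) t (by omega) (by omega))
        (h (i + 1 - 1) t (by omega) (by omega)) (h (i + 1) (t - 1) (by omega) (by omega)) hab ht
      simpa using this
    · have h5 := emb_eq_across_wall_two hX (h i t (by omega) (by omega))
        (h (i - 1) t (by omega) (by omega)) (h i (t - 1) (by omega) (by omega)) hab ht
      have := emb_eq_across_wall_zero hX (i := i - 1) (j := t + 1) h5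
        (by simpa using h i t (by omega) (by omega))
        (by simpa using h (i - 1) t (by omega) (by omega)) hab (by omega)
      simpa using this
  have h1 : ∀ s : ℕ, k + s ≤ a → Q (k + s) k := fun s => by
    induction s with
    | zero => intro _; simpa using start
    | succ s ih =>
      intro hs
      push_cast at hs ⊢
      rw [← add_assoc]
      exact right _ _ (by omega) hk3 (ih (by omega))
  have h2 : Q a k := by
    have := h1 (a - k).toNat (by omega)
    rwa [show k + ((a - k).toNat : ℤ) = a by omega] at this
  have h3 : ∀ s : ℕ, k + s ≤ b → Q a (k + s) := fun s => by
    induction s with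
    | zero => intro _; simpa using h2
    | succ s ih =>
      intro hs
      push_cast at hs ⊢
      rw [← add_assoc]
      exact up _ _ le_rfl (by omega) (ih (by omega))
  exact h3 (b - k).toNat (by omega) i j hi (by omega)

/-- There are at most `q` further chambers on a panel. -/
theorem encard_across_panel_le {q : ℕ} (hq : HasParameter X q) (φ : Chart X) {u v w : Coweight}
    (h : Tri u v w) :
    {x | ∃ ψ : Chart X, AgreeOn φ ψ u v w ∧ ψ.emb (u + v - w) = x}.encard ≤ q := by
  classical
  have he := hq (({u, v} : Finset Coweight).map φ.emb)
    (φ.map_mem _ (mem_faces_of_adj h.adj1)) (by rw [Finset.card_map, Finset.card_pair h.ne1])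
  set S := {C : Finset V | C ∈ X.cplx.faces ∧ C.card = 3 ∧
    ({u, v} : Finset Coweight).map φ.emb ⊆ C} with hS
  set C₀ := ({u, v, w} : Finset Coweight).map φ.emb with hC₀
  have hC : C₀ ∈ S := ⟨φ.map_mem _ h.mem_faces, h.card_map φ, by
    rw [hC₀, Finset.map_subset_map]; intro x; simp; tauto⟩
  -- The given chamber is one of the q + 1 on the panel; the others are told apart by their third
  -- vertices.
  have hcard := Set.encard_sdiff_singleton_add_one hC
  rw [he] at hcard
  rw [← ENat.add_left_injective_of_ne_top ENat.one_ne_top hcard]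
  refine Set.encard_le_encard_of_injOn (f := fun x => {φ.emb u, φ.emb v, x}) ?_ ?_
  · rintro x ⟨ψ, hψ, rfl⟩
    have e : ({φ.emb u, φ.emb v, ψ.emb (u + v - w)} : Finset V) =
        ({u, v, u + v - w} : Finset Coweight).map ψ.emb := by
      ext x; simp [hψ.eq1, hψ.eq2]
    simp only [e]
    refine ⟨⟨ψ.map_mem _ h.opp.mem_faces, h.opp.card_map ψ, ?_⟩, ?_⟩
    · rw [← e]; intro x; simp; tauto
    · intro (heq : _ = _)
      have hm : ψ.emb (u + v - w) ∈ C₀ := heq ▸ Finset.mem_map_of_mem _ (by simp)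
      simp only [hC₀, Finset.mem_map, Finset.mem_insert, Finset.mem_singleton] at hm
      obtain ⟨a, rfl | rfl | rfl, ha⟩ := hm
      · exact h.opp.ne3 (ψ.emb.injective (hψ.eq1.symm.trans ha))
      · exact h.opp.ne2 (ψ.emb.injective (hψ.eq2.symm.trans ha))
      · exact h.opp_ne.symm (ψ.emb.injective (hψ.eq3.symm.trans ha))
  · rintro x ⟨ψ, hψ, rfl⟩ y ⟨ψ', hψ', rfl⟩ hxy
    have hm : ψ.emb (u + v - w) ∈ ({φ.emb u, φ.emb v, ψ'.emb (u + v - w)} : Finset V) := by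
      have : ({φ.emb u, φ.emb v, ψ.emb (u + v - w)} : Finset V) = 
        {φ.emb u, φ.emb v, ψ'.emb (u + v - w)} := hxy
      rw [← this]; simp
    simp only [Finset.mem_insert, Finset.mem_singleton] at hm
    rcases hm with hm | hm | hm
    · exact absurd (ψ.emb.injective (hm.trans hψ.eq1)) h.opp.ne3.symm
    · exact absurd (ψ.emb.injective (hm.trans hψ.eq2)) h.opp.ne2.symm
    · exact hm

/-- The parameter is positive. -/
theorem one_le_of_hasParameter {q : ℕ} (hq : HasParameter X q) (φ : Chart X) : 1 ≤ q := by
  by_contra h0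
  obtain rfl : q = 0 := by omega
  have h := encard_across_panel_le hq φ (Tri.add_smul 0 0)
  simp only [Nat.cast_zero, nonpos_iff_eq_zero, Set.encard_eq_zero] at h
  rw [Set.eq_empty_iff_forall_notMem] at h
  exact h _ ⟨φ, ⟨Tri.add_smul 0 0, rfl, rfl, rfl⟩, rfl⟩

/-- The link of a vertex has no circuits of length four. -/
theorem link_no_four_circuit (hX : IsTriangleBuilding X) {φ₁ φ₂ φ₃ φ₄ : Chart X}
    {u v w : Coweight} (h : Tri u v w) (hu2 : φ₁.emb u = φ₂.emb u) (hu3 : φ₁.emb u = φ₃.emb u)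
    (hu4 : φ₁.emb u = φ₄.emb u) (h12 : φ₁.emb v = φ₂.emb v) (h13 : φ₁.emb w = φ₃.emb w)
    (h34 : φ₃.emb v = φ₄.emb v) (h24 : φ₂.emb w = φ₄.emb w) :
    φ₁.emb v = φ₃.emb v ∨ φ₁.emb w = φ₂.emb w := by
  -- Put the first and the fourth chamber into one apartment. If the circuit were proper, its two
  -- further vertices would be the mirror images of `v` and `w` there; these are not adjacent, as
  -- the link of a vertex of Σ is a hexagon.
  by_contra! hne
  obtain ⟨ψ, hψ, ht⟩ := exists_agreeOn hX φ₁ h (φ₄.map_mem _ h.mem_faces)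
  obtain ⟨v', hv'⟩ := Chart.exists_of_mem_image ht (x := φ₄.emb v) (by simp)
  obtain ⟨w', hw'⟩ := Chart.exists_of_mem_image ht (x := φ₄.emb w) (by simp)
  have adj1 : Adj v' w' := Chart.adj_of_mem_image ht (by simp [hv']) (by simp [hw'])
  have adj2 : Adj u v' := Chart.adj_of_mem_image ht (by simp [← hψ.eq1, hu4]) (by simp [hv'])
  have adj3 : Adj u w' := Chart.adj_of_mem_image ht (by simp [← hψ.eq1, hu4]) (by simp [hw'])
  -- The second and third chambers need not lie in this apartment. Retracting onto it keeps those of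
  -- their vertices that do, so adjacency can be read off in its coordinates.
  have key : ∀ {a b : Coweight} {t : Finset V}, t ∈ X.cplx.faces → ψ.emb a ∈ t → ψ.emb b ∈ t →
      Adj a b := fun {a b t} ht ha hb => by
    obtain ⟨χ, hχ, ht'⟩ := exists_agreeOn hX ψ h ht
    obtain ⟨a', ha'⟩ := Chart.exists_of_mem_image ht' ha
    obtain ⟨b', hb'⟩ := Chart.exists_of_mem_image ht' hb
    rw [hχ.eq_of_emb_eq hX ha'.symm, hχ.eq_of_emb_eq hX hb'.symm]
    exact Chart.adj_of_mem_image ht' (ha' ▸ ha) (hb' ▸ hb)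
  have adj4 : Adj v w' := key (φ₂.map_mem _ h.mem_faces) (by simp [← hψ.eq2, h12])
    (by simp [hw', ← h24])
  have adj5 : Adj w v' := key (φ₃.map_mem _ h.mem_faces) (by simp [← hψ.eq3, h13])
    (by simp [hv', ← h34])
  have nv : v' ≠ v := by rintro rfl; exact hne.1 (hψ.eq2.trans (hv'.trans h34.symm))
  have nw : w' ≠ w := by rintro rfl; exact hne.2 (hψ.eq3.trans (hw'.trans h24.symm))
  have nvu : v' ≠ u := by
    rintro rfl
    exact h.ne1 (φ₄.emb.injective (hu4.symm.trans (hψ.eq1.trans hv')))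
  have nwu : w' ≠ u := by
    rintro rfl
    exact h.ne3 (φ₄.emb.injective (hu4.symm.trans (hψ.eq1.trans hw')))
  have nwv : w' ≠ v := by
    rintro rfl
    exact h.ne2 (φ₂.emb.injective (h12.symm.trans (hψ.eq2.trans (hw'.trans h24.symm))))
  have nvw : v' ≠ w := by
    rintro rfl
    exact h.ne2 (φ₃.emb.injective (h34.trans (hv'.symm.trans (hψ.eq3.symm.trans h13))))
  have e1 := (h.third adj3 adj4 nwu nwv).resolve_left nw
  have ht2 : Tri u w v := h.rotate.rotate.swap
  have e2 := (ht2.third adj2 adj5 nvu nvw).resolve_left nv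
  subst e1 e2
  have h1 := h.adj2
  have h2 := h.ne2
  obtain ⟨a, b⟩ := u
  obtain ⟨c, d⟩ := v
  obtain ⟨x, y⟩ := w
  simp only [HexLe, ne_eq, Prod.mk.injEq, Prod.mk_add_mk, Prod.mk_sub_mk] at h1 h2 adj1
  omega

end TriangleBuilding

namespace TriangleBuilding

variable {V : Type*} {X : TypedComplex V}

/-! ### Sectors -/

theorem weyl_add_adj {w : Equiv.Perm Coweight} (hw : w ∈ finiteWeylGroup) :
    (∀ x y, w (x + y) = w x + w y) ∧ ∀ u v, Adj (w u) (w v) ↔ Adj u v := by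
  induction hw using Subgroup.closure_induction with
  | mem w hw =>
    rcases hw with rfl | rfl
    · refine ⟨fun x y => ?_, fun u v => ?_⟩
      · ext <;> simp [refl1] <;> ring
      · simp only [HexLe, refl1, Equiv.coe_fn_mk]; omega
    · refine ⟨fun x y => ?_, fun u v => ?_⟩
      · ext <;> simp [refl2] <;> ring
      · simp only [HexLe, refl2, Equiv.coe_fn_mk]; omega
  | one => simp
  | mul a b _ _ ha hb =>
    exact ⟨fun x y => by simp [ha.1, hb.1], fun u v => by simp [ha.2, hb.2]⟩
  | inv a _ ha =>
    refine ⟨fun x y => ?_, fun u v => ?_⟩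
    · apply a.injective
      rw [ha.1]
      simp
    · rw [← ha.2]; simp

theorem weyl_add {w : Equiv.Perm Coweight} (hw : w ∈ finiteWeylGroup) (x y : Coweight) :
    w (x + y) = w x + w y := (weyl_add_adj hw).1 x y

theorem weyl_adj {w : Equiv.Perm Coweight} (hw : w ∈ finiteWeylGroup) {u v : Coweight} :
    Adj (w u) (w v) ↔ Adj u v := (weyl_add_adj hw).2 u v

theorem mem_coxeterSector {μ ν : Coweight} {w : Equiv.Perm Coweight} :
    ν ∈ coxeterSector μ w ↔ w.symm (ν - μ) ∈ fundamentalSector := by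
  constructor
  · rintro ⟨κ, hκ, rfl⟩
    simpa using hκ
  · intro h
    exact ⟨_, h, by simp⟩

theorem tri_zero : Tri 0 lam1 lam2 := by
  constructor <;> simp [HexLe, lam1, lam2, Prod.ext_iff]

/-- A map of the plane that preserves adjacency and is injective is affine. -/
theorem affine_of_adj {g : Coweight → Coweight} (hg : Function.Injective g)
    (hadj : ∀ u v, Adj u v → Adj (g u) (g v)) (μ : Coweight) :
    g μ = g 0 + μ.1 • (g lam1 - g 0) + μ.2 • (g lam2 - g 0) := by
  have ht : Tri 0 lam1 lam2 := tri_zero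
  refine forall_of_tri (p := fun μ => g μ = g 0 + μ.1 • (g lam1 - g 0) + μ.2 • (g lam2 - g 0))
    ?_ ht (by simp) (by simp [lam1]) (by simp [lam2]) μ
  intro u v w h hu hv hw
  have hgt : Tri (g u) (g v) (g w) := ⟨hadj _ _ h.adj1, hadj _ _ h.adj2, hadj _ _ h.adj3,
    hg.ne h.ne1, hg.ne h.ne2, hg.ne h.ne3⟩
  have e := (hgt.third (hadj _ _ h.opp.adj3) (hadj _ _ h.opp.adj2) (hg.ne h.opp.ne3.symm)
    (hg.ne h.opp.ne2.symm)).resolve_left (hg.ne h.opp_ne)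
  rw [e, hu, hv, hw]
  ext <;> simp <;> ring

/-- An affine image of the fundamental sector inside the fundamental sector that preserves
adjacency is a translate of it. -/
theorem image_fundamentalSector {g : Coweight → Coweight} (hg : Function.Injective g)
    (hadj : ∀ u v, Adj u v → Adj (g u) (g v)) {μ : Coweight}
    (h : ∀ κ ∈ fundamentalSector, g κ - μ ∈ fundamentalSector) :
    g '' fundamentalSector = {ν | ν - g 0 ∈ fundamentalSector} := by
  have haff := affine_of_adj hg hadj
  have ht : Tri 0 lam1 lam2 := tri_zero
  have a1 := hadj _ _ ht.adj1
  have a2 := hadj _ _ ht.adj2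
  have a3 := hadj _ _ ht.adj3
  have n1 := hg.ne ht.ne1
  have n2 := hg.ne ht.ne2
  have n3 := hg.ne ht.ne3
  generalize g lam1 = e at *
  generalize g lam2 = e' at *
  generalize hz : g 0 = z at *
  obtain ⟨a, b⟩ := e
  obtain ⟨a', b'⟩ := e'
  obtain ⟨x, y⟩ := z
  obtain ⟨m1, m2⟩ := μ
  have key : ∀ s t : ℤ, 0 ≤ s → 0 ≤ t → 0 ≤ x + s * (a - x) + t * (a' - x) - m1 ∧
      0 ≤ y + s * (b - y) + t * (b' - y) - m2 := fun s t hs ht => by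
    have := h (s, t) ⟨hs, ht⟩
    rw [haff] at this
    simpa [fundamentalSector] using this
  have k0 := key 0 0 le_rfl le_rfl
  -- A negative slope would leave the sector far out. At 0 the distances to its walls are x - m1 and
  -- y - m2, so their sum plus one is far enough for either coordinate.
  have k1 := key (x - m1 + (y - m2) + 1) 0 (by omega) le_rfl
  have k2 := key 0 (x - m1 + (y - m2) + 1) le_rfl (by omega)
  simp only [HexLe, ne_eq, Prod.mk.injEq] at a1 a2 a3 n1 n2 n3
  have nn : ∀ c d k l : ℤ, 0 ≤ c → 0 ≤ d → 0 ≤ k + (c + d + 1) * l - (k - c) → 0 ≤ l := by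
    intro c d k l hc hd hl
    by_contra hneg
    have : (c + d + 1) * l ≤ (c + d + 1) * (-1) :=
      mul_le_mul_of_nonneg_left (by omega) (by omega)
    linarith
  have p1 : 0 ≤ a - x := nn (x - m1) (y - m2) x _ (by linarith) (by linarith) (by linarith)
  have p2 : 0 ≤ b - y := nn (y - m2) (x - m1) y _ (by linarith) (by linarith) (by linarith)
  have p3 : 0 ≤ a' - x := nn (x - m1) (y - m2) x _ (by linarith) (by linarith) (by linarith)
  have p4 : 0 ≤ b' - y := nn (y - m2) (x - m1) y _ (by linarith) (by linarith) (by linarith)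
  -- The only edges with nonnegative coordinates are λ₁ and λ₂; the map may exchange them.
  have cases : (a = x + 1 ∧ b = y ∧ a' = x ∧ b' = y + 1) ∨
      (a = x ∧ b = y + 1 ∧ a' = x + 1 ∧ b' = y) := by
    clear key k0 k1 k2 nn haff h
    omega
  ext ⟨r, s⟩
  simp only [Set.mem_image, Set.mem_ofPred_eq, fundamentalSector, Prod.fst_sub, Prod.snd_sub]
  rcases cases with ⟨rfl, rfl, rfl, rfl⟩ | ⟨rfl, rfl, rfl, rfl⟩
  · constructor
    · rintro ⟨κ, hκ, e⟩
      rw [haff] at e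
      simp [Prod.ext_iff] at e
      omega
    · intro hh
      refine ⟨(r - a', s - b), hh, ?_⟩
      rw [haff]
      ext <;> simp
  · constructor
    · rintro ⟨κ, hκ, e⟩
      rw [haff] at e
      simp [Prod.ext_iff] at e
      omega
    · intro hh
      refine ⟨(s - b', r - a), ⟨hh.2, hh.1⟩, ?_⟩
      rw [haff]
      ext <;> simp

/-- A sector contained in a sector of a chart is a sector of this chart with the same direction. -/
theorem IsSector.eq_onSet (hX : IsTriangleBuilding X) {T : Set (Finset V)} (hT : IsSector X T)
    {χ : Chart X} {μ : Coweight} {w : Equiv.Perm Coweight} (hw : w ∈ finiteWeylGroup)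
    (hTχ : T ⊆ χ.onSet (coxeterSector μ w)) : ∃ ν, T = χ.onSet (coxeterSector ν w) := by
  obtain ⟨ψ, ν, w', hw', rfl⟩ := hT
  have hmem : ∀ κ ∈ coxeterSector ν w', ∃ κ', κ' ∈ coxeterSector μ w ∧ χ.emb κ' = ψ.emb κ := by
    intro κ hκ
    have := (Chart.mem_onSet.1 (hTχ (Chart.singleton_mem_onSet.2 hκ))).2 _
      (Finset.mem_singleton_self _)
    exact this
  have ht : Tri 0 lam1 lam2 := tri_zero
  have htri : ∀ {u v x}, Tri u v x → Tri (ν + w' u) (ν + w' v) (ν + w' x) := fun {u v x} h => by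
    have hA : ∀ {a b}, Adj a b → Adj (ν + w' a) (ν + w' b) := fun {a b} hab => by
      have := (weyl_adj hw').2 hab
      simp only [HexLe, Prod.fst_add, Prod.snd_add] at this ⊢
      omega
    have hN : ∀ {a b}, a ≠ b → ν + w' a ≠ ν + w' b := fun {a b} hab e =>
      hab (w'.injective (add_left_cancel e))
    exact ⟨hA h.adj1, hA h.adj2, hA h.adj3, hN h.ne1, hN h.ne2, hN h.ne3⟩
  have hC : ({ν + w' 0, ν + w' lam1, ν + w' lam2} : Finset Coweight).map ψ.emb ∈
      ψ.onSet (coxeterSector ν w') := by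
    refine ⟨_, (htri ht).mem_faces, ?_, rfl⟩
    simp only [Finset.mem_insert, Finset.mem_singleton]
    rintro x (rfl | rfl | rfl)
    · exact ⟨0, by simp [fundamentalSector], rfl⟩
    · exact ⟨lam1, by simp [fundamentalSector, lam1], rfl⟩
    · exact ⟨lam2, by simp [fundamentalSector, lam2], rfl⟩
  -- φ parametrizes the apartment of χ and agrees with ψ on `T`, so `g` = χ⁻¹ ∘ φ is an injective
  -- adjacency-preserving self-map of Σ, hence affine.
  obtain ⟨φ, hφ, hφ'⟩ := hX.exists_iso ψ χ ⟨_, (htri ht).card_map ψ, (htri ht).map_mem_image ψ,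
    χ.onSet_subset_image _ (hTχ hC)⟩
  have hφψ : ∀ κ ∈ coxeterSector ν w', φ.emb κ = ψ.emb κ := fun κ hκ => by
    obtain ⟨κ', -, e⟩ := hmem κ hκ
    exact hφ' κ (Chart.singleton_mem_image.2 ⟨κ', e⟩)
  have hg : ∀ κ, ∃ κ', χ.emb κ' = φ.emb κ := fun κ =>
    Chart.singleton_mem_image.1 (hφ ▸ Chart.singleton_mem_image.2 ⟨κ, rfl⟩)
  choose g hg using hg
  have ginj : Function.Injective g := fun a b e => φ.emb.injective (by rw [← hg, ← hg, e])
  have gadj : ∀ u v, Adj u v → Adj (g u) (g v) := fun u v huv => by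
    have h := φ.map_mem_image (mem_faces_of_adj huv)
    rw [hφ] at h
    exact Chart.adj_of_mem_image h (by simp [hg]) (by simp [hg])
  have e1 : ψ.onSet (coxeterSector ν w') = χ.onSet (g '' coxeterSector ν w') := by
    have himg : χ.emb '' (g '' coxeterSector ν w') = ψ.emb '' coxeterSector ν w' := by
      rw [Set.image_image]
      exact Set.image_congr fun κ hκ => by rw [hg, hφψ κ hκ]
    ext t
    rw [Chart.mem_onSet (φ := χ), himg]
    constructor
    · intro h
      exact ⟨χ.onSet_subset_image _ (hTχ h), (Chart.mem_onSet.1 h).2⟩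
    · rintro ⟨h1, h2⟩
      rw [← hφ] at h1
      obtain ⟨s, hs, rfl⟩ := Chart.mem_image.1 h1
      have hsub : ∀ κ ∈ s, κ ∈ coxeterSector ν w' := fun κ hκ => by
        obtain ⟨κ', hκ', e⟩ := h2 _ (Finset.mem_map_of_mem _ hκ)
        rw [← hφψ κ' hκ'] at e
        rwa [← φ.emb.injective e]
      refine ⟨s, hs, hsub, ?_⟩
      classical
      rw [Finset.map_eq_image, Finset.map_eq_image]
      exact Finset.image_congr fun κ hκ => hφψ κ (hsub κ hκ)
  have hwi : w⁻¹ ∈ finiteWeylGroup := inv_mem hw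
  have gmem : ∀ κ ∈ coxeterSector ν w', g κ ∈ coxeterSector μ w := fun κ hκ => by
    obtain ⟨κ', h1, h2⟩ := hmem κ hκ
    rwa [χ.emb.injective ((hg κ).trans ((hφψ κ hκ).trans h2.symm))]
  have hsub : ∀ a b : Coweight, w⁻¹ (a - b) = w⁻¹ a - w⁻¹ b := fun a b => by
    rw [eq_sub_iff_add_eq, ← weyl_add hwi, sub_add_cancel]
  have himage := image_fundamentalSector (g := fun κ => w⁻¹ (g (ν + w' κ))) (μ := w⁻¹ μ)
    (fun a b e => w'.injective (add_left_cancel (ginj (w⁻¹.injective e))))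
    (fun u v huv => (weyl_adj hwi).2 (gadj _ _ (by
      have := (weyl_adj hw').2 huv
      simp only [HexLe, Prod.fst_add, Prod.snd_add] at this ⊢
      omega)))
    (fun κ hκ => by
      rw [← hsub]
      exact mem_coxeterSector.1 (gmem _ ⟨κ, hκ, rfl⟩))
  refine ⟨g (ν + w' 0), e1.trans (congrArg _ ?_)⟩
  ext κ
  rw [mem_coxeterSector]
  have h1 : w⁻¹ κ ∈ (fun κ => w⁻¹ (g (ν + w' κ))) '' fundamentalSector ↔
      κ ∈ g '' coxeterSector ν w' := by
    constructor
    · rintro ⟨a, ha, e⟩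
      exact ⟨_, ⟨a, ha, rfl⟩, w⁻¹.injective e⟩
    · rintro ⟨_, ⟨a, ha, rfl⟩, rfl⟩
      exact ⟨a, ha, rfl⟩
  rw [← h1, himage, Set.mem_ofPred_eq, ← hsub]
  rfl

theorem subset_coxeterSector_of_mem {μ ν : Coweight} {w : Equiv.Perm Coweight}
    (hw : w ∈ finiteWeylGroup) (h : ν ∈ coxeterSector μ w) :
    coxeterSector ν w ⊆ coxeterSector μ w := by
  obtain ⟨κ, hκ, rfl⟩ := h
  rintro _ ⟨κ', hκ', rfl⟩
  exact ⟨κ + κ', ⟨add_nonneg hκ.1 hκ'.1, add_nonneg hκ.2 hκ'.2⟩, by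
    simp only [weyl_add hw, add_assoc]⟩

theorem exists_mem_coxeterSector_inter {w : Equiv.Perm Coweight} (hw : w ∈ finiteWeylGroup)
    (μ ν : Coweight) : ∃ κ, κ ∈ coxeterSector μ w ∧ κ ∈ coxeterSector ν w := by
  set d := w⁻¹ (μ - ν) with hd
  have hd' : w d = μ - ν := by simp [hd]
  refine ⟨μ + w (|d.1|, |d.2|), ⟨_, ⟨abs_nonneg _, abs_nonneg _⟩, rfl⟩, d + (|d.1|, |d.2|), ?_, ?_⟩
  · have h1 := neg_abs_le d.1
    have h2 := neg_abs_le d.2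
    constructor <;> simp <;> linarith
  · simp only [weyl_add hw, hd']
    abel

/-- The direction of `-S₀`. -/
def weylLongest : Equiv.Perm Coweight := refl1 * refl2 * refl1

theorem weylLongest_mem : weylLongest ∈ finiteWeylGroup :=
  mul_mem (mul_mem (Subgroup.subset_closure (by simp)) (Subgroup.subset_closure (by simp)))
    (Subgroup.subset_closure (by simp))

theorem coxeterSector_weylLongest (μ : Coweight) :
    coxeterSector μ weylLongest = {ν | ν.1 ≤ μ.1 ∧ ν.2 ≤ μ.2} := by
  have h : ∀ κ : Coweight, weylLongest κ = (-κ.2, -κ.1) := fun κ => by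
    ext <;> simp [weylLongest, refl1, refl2]
  ext ν
  constructor
  · rintro ⟨κ, hκ, rfl⟩
    simp only [h, Set.mem_ofPred_eq, Prod.fst_add, Prod.snd_add]
    have := hκ.1
    have := hκ.2
    constructor <;> linarith
  · rintro ⟨h1, h2⟩
    refine ⟨(μ.2 - ν.2, μ.1 - ν.1), ⟨by simpa using h2, by simpa using h1⟩, ?_⟩
    simp only [h]
    ext <;> simp

/-! ### The charts centred at `ω₀` -/

/-- The charts whose inverse is the restriction of `ρ` to an apartment. -/
def IsHoro (b : Frame X) (φ : Chart X) : Prop :=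
  ∃ n : ℤ, ∀ i j, i ≤ n → j ≤ n → φ.emb (i, j) = b.chart.emb (i, j)

/-- The given sector and the reference sector each share a subsector with a fixed representative of
ω₀. These two have the same direction, hence contain a third, which lies in `A` and in the reference
apartment. The isomorphism fixing the intersection of the two apartments provides the chart. -/
theorem exists_isHoro (hX : IsTriangleBuilding X) (b : Frame X) {A : Set (Finset V)}
    (hA : IsApartment X A) {S : Set (Finset V)} (hS : S ∈ b.omega.1) (hSA : S ⊆ A) :
    ∃ φ : Chart X, φ.image = A ∧ IsHoro b φ := by
  obtain ⟨R, hR, hω⟩ := b.omega.2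
  have hb := b.sector_mem
  rw [hω] at hb hS
  obtain ⟨-, T₁, hT₁, h11, h12⟩ := hb
  obtain ⟨-, T₂, hT₂, h21, h22⟩ := hS
  obtain ⟨χ, μ, w, hw, rfl⟩ := hR
  obtain ⟨μ₁, rfl⟩ := hT₁.eq_onSet hX hw h11
  obtain ⟨μ₂, rfl⟩ := hT₂.eq_onSet hX hw h21
  obtain ⟨μ₃, h31, h32⟩ := exists_mem_coxeterSector_inter hw μ₁ μ₂
  have hT : IsSector X (χ.onSet (coxeterSector μ₃ w)) := ⟨χ, μ₃, w, hw, rfl⟩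
  have h0 : {μ : Coweight | μ.1 ≤ 0 ∧ μ.2 ≤ 0} = coxeterSector 0 weylLongest := by
    rw [coxeterSector_weylLongest]; rfl
  rw [h0] at h12
  obtain ⟨μ₄, h4⟩ := hT.eq_onSet hX weylLongest_mem
    ((χ.onSet_mono (subset_coxeterSector_of_mem hw h31)).trans h12)
  have hsub : b.chart.onSet (coxeterSector μ₄ weylLongest) ⊆ A :=
    h4 ▸ (χ.onSet_mono (subset_coxeterSector_of_mem hw h32)).trans (h22.trans hSA)
  rw [coxeterSector_weylLongest] at hsub
  obtain ⟨ψ, rfl⟩ := hA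
  have ht := Tri.sub_smul μ₄.1 μ₄.2
  have hC : ({(μ₄.1, μ₄.2), (μ₄.1 - 1, μ₄.2), (μ₄.1, μ₄.2 - 1)} : Finset Coweight).map b.chart.emb ∈
      ψ.image := hsub ⟨_, ht.mem_faces, by simp, rfl⟩
  obtain ⟨φ, hφ, hφ'⟩ := hX.exists_iso b.chart ψ ⟨_, ht.card_map _, ht.map_mem_image _, hC⟩
  refine ⟨φ, hφ, min μ₄.1 μ₄.2, fun i j hi hj => hφ' _ (hsub ?_)⟩
  exact Chart.singleton_mem_onSet.2 ⟨hi.trans (min_le_left _ _), hj.trans (min_le_right _ _)⟩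

theorem retractsTo_iff {b : Frame X} {x : V} {μ : Coweight} :
    RetractsTo b x μ ↔ ∃ φ : Chart X, IsHoro b φ ∧ φ.emb μ = x := by
  constructor
  · rintro ⟨φ, h, ν, hν⟩
    exact ⟨φ, ⟨min ν.1 ν.2, fun i j hi hj =>
      hν _ (hi.trans (min_le_left _ _)) (hj.trans (min_le_right _ _))⟩, h⟩
  · rintro ⟨φ, ⟨n, hn⟩, h⟩
    exact ⟨φ, h, (n, n), fun κ h1 h2 => hn _ _ h1 h2⟩

theorem IsHoro.exists_agree {b : Frame X} {φ ψ : Chart X} (hφ : IsHoro b φ) (hψ : IsHoro b ψ) :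
    ∃ n : ℤ, ∀ i j, i ≤ n → j ≤ n → φ.emb (i, j) = ψ.emb (i, j) := by
  obtain ⟨n, hn⟩ := hφ
  obtain ⟨k, hk⟩ := hψ
  refine ⟨min n k, fun i j hi hj => ?_⟩
  rw [hn i j (by omega) (by omega), hk i j (by omega) (by omega)]

/-- Two such charts agree on a chamber far towards ω₀; this is why ρ is well defined. -/
theorem IsHoro.eq_of_emb_eq (hX : IsTriangleBuilding X) {b : Frame X} {φ ψ : Chart X}
    (hφ : IsHoro b φ) (hψ : IsHoro b ψ) {μ ν : Coweight} (h : φ.emb μ = ψ.emb ν) : μ = ν := by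
  obtain ⟨n, hn⟩ := hφ.exists_agree hψ
  exact AgreeOn.eq_of_emb_eq hX ⟨Tri.sub_smul n n, hn _ _ le_rfl le_rfl, hn _ _ (by omega) le_rfl,
    hn _ _ le_rfl (by omega)⟩ h

theorem exists_horoChart (hX : IsTriangleBuilding X) (b : Frame X) (ω : Omega0 b) :
    ∃ φ : Chart X, φ.image = spannedApartment ω.2 ∧ IsHoro b φ := by
  obtain ⟨hA, -, S, hS, hSA⟩ := ω.2.exists.choose_spec
  exact exists_isHoro hX b hA hS hSA

/-- The chart of the apartment `[ω, ω₀]` that is the inverse of the restriction of `ρ`. -/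
noncomputable def horoChart (hX : IsTriangleBuilding X) (b : Frame X) (ω : Omega0 b) : Chart X :=
  (exists_horoChart hX b ω).choose

theorem horoChart_image (hX : IsTriangleBuilding X) (b : Frame X) (ω : Omega0 b) :
    (horoChart hX b ω).image = spannedApartment ω.2 := (exists_horoChart hX b ω).choose_spec.1

theorem isHoro_horoChart (hX : IsTriangleBuilding X) (b : Frame X) (ω : Omega0 b) :
    IsHoro b (horoChart hX b ω) := (exists_horoChart hX b ω).choose_spec.2

theorem E_eq (hX : IsTriangleBuilding X) {b : Frame X} {x : V} {μ : Coweight}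
    (h : RetractsTo b x μ) : E b x = {ω | (horoChart hX b ω).emb μ = x} := by
  obtain ⟨φ, hφ, rfl⟩ := retractsTo_iff.1 h
  ext ω
  simp only [E, Set.mem_ofPred_eq, ← horoChart_image hX, Chart.singleton_mem_image]
  constructor
  · rintro ⟨ν, hν⟩
    rwa [(isHoro_horoChart hX b ω).eq_of_emb_eq hX hφ hν] at hν
  · exact fun h => ⟨μ, h⟩

end TriangleBuilding

namespace TriangleBuilding

/-! ### Horospherical coordinates -/

/-- The properties of the vertices `Y i j ω` with coordinates `(i, j)` of the apartments `[ω, ω₀]`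
on which the martingale estimates depend. They are symmetric in `i` and `j`. -/
structure HoroSystem {Ω V : Type*} [mΩ : MeasurableSpace Ω] (m : Measure Ω) (q : ℕ)
    (Y : ℤ → ℤ → Ω → V) (F : ℤ → ℤ → MeasurableSpace Ω) : Prop where
  one_le : 1 ≤ q
  le : ∀ i j, F i j ≤ mΩ
  gen : ∀ i j, F i j = MeasurableSpace.generateFrom {s | ∃ ω, s = {ω' | Y i j ω' = Y i j ω}}
  meas : ∀ i j ω, m {ω' | Y i j ω' = Y i j ω} = (q : ℝ≥0∞) ^ (-2 * (i + j))
  start : ∀ ω ω', ∃ n, Y n n ω' = Y n n ω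
  mono : ∀ {ω ω' i j a b}, Y a b ω' = Y a b ω → i ≤ a → j ≤ b → Y i j ω' = Y i j ω
  conv0 : ∀ {ω ω' i j a b}, Y i j ω' = Y i j ω → Y (i + 1) (j - 1) ω' = Y (i + 1) (j - 1) ω →
    Y i (j - 1) ω' = Y i (j - 1) ω → Y a b ω' = Y a b ω → i + j < a + b →
    Y (i + 1) j ω' = Y (i + 1) j ω
  conv1 : ∀ {ω ω' i j a b}, Y i j ω' = Y i j ω → Y i (j - 1) ω' = Y i (j - 1) ω →
    Y (i - 1) j ω' = Y (i - 1) j ω → Y a b ω' = Y a b ω → i < a →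
    Y (i + 1) (j - 1) ω' = Y (i + 1) (j - 1) ω
  conv2 : ∀ {ω ω' i j a b}, Y i j ω' = Y i j ω → Y (i - 1) j ω' = Y (i - 1) j ω →
    Y i (j - 1) ω' = Y i (j - 1) ω → Y a b ω' = Y a b ω → j < b →
    Y (i - 1) (j + 1) ω' = Y (i - 1) (j + 1) ω
  card0 : ∀ ω i j, {x | ∃ ω', Y i j ω' = Y i j ω ∧ Y (i + 1) (j - 1) ω' = Y (i + 1) (j - 1) ω ∧
    Y i (j - 1) ω' = Y i (j - 1) ω ∧ Y (i + 1) j ω' = x}.encard ≤ q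
  card1 : ∀ ω i j, {x | ∃ ω', Y i j ω' = Y i j ω ∧ Y i (j - 1) ω' = Y i (j - 1) ω ∧
    Y (i - 1) j ω' = Y (i - 1) j ω ∧ Y (i + 1) (j - 1) ω' = x}.encard ≤ q
  card2 : ∀ ω i j, {x | ∃ ω', Y i j ω' = Y i j ω ∧ Y (i - 1) j ω' = Y (i - 1) j ω ∧
    Y i (j - 1) ω' = Y i (j - 1) ω ∧ Y (i - 1) (j + 1) ω' = x}.encard ≤ q
  girth : ∀ {ω₁ ω₂ ω₃ ω₄ i j}, Y (i + 1) j ω₁ = Y (i + 1) j ω₂ →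
    Y i (j + 1) ω₁ = Y i (j + 1) ω₃ → Y (i + 1) j ω₃ = Y (i + 1) j ω₄ →
    Y i (j + 1) ω₂ = Y i (j + 1) ω₄ →
    Y (i + 1) j ω₁ = Y (i + 1) j ω₃ ∨ Y i (j + 1) ω₁ = Y i (j + 1) ω₂

/-- This gives the second half of the proposition. Only `conv0` and `card0` need an index shift,
because their panel joins (i, j) to (i+1, j-1) and is traversed backwards. -/
theorem HoroSystem.swap {Ω V : Type*} [mΩ : MeasurableSpace Ω] {m : Measure Ω} {q : ℕ}
    {Y : ℤ → ℤ → Ω → V} {F : ℤ → ℤ → MeasurableSpace Ω} (h : HoroSystem m q Y F) :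
    HoroSystem m q (fun i j => Y j i) (fun i j => F j i) where
  one_le := h.one_le
  le i j := h.le j i
  gen i j := h.gen j i
  meas i j ω := by rw [h.meas, add_comm]
  start := h.start
  mono h1 h2 h3 := h.mono h1 h3 h2
  conv0 {ω ω' i j a b} h1 h2 h3 h4 h5 := by
    have := h.conv0 (i := j - 1) (j := i + 1) (by simpa using h2) (by simpa using h1)
      (by simpa using h3) h4 (by omega)
    simpa using this
  conv1 h1 h2 h3 h4 h5 := h.conv2 h1 h2 h3 h4 h5
  conv2 h1 h2 h3 h4 h5 := h.conv1 h1 h2 h3 h4 h5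
  card0 ω i j := by
    refine le_trans (Set.encard_le_encard ?_) (h.card0 ω (j - 1) (i + 1))
    rintro x ⟨ω', h1, h2, h3, h4⟩
    exact ⟨ω', h2, by simpa using h1, by simpa using h3, by simpa using h4⟩
  card1 ω i j := h.card2 ω j i
  card2 ω i j := h.card1 ω j i
  girth h1 h2 h3 h4 := (h.girth h2 h1 h4 h3).symm

variable {V : Type*} {X : TypedComplex V}

/-- The only passage from the building to the analysis: convexity, panel counts and girth of links
become statements about the functions `Y i j`. -/
theorem horoSystem (hX : IsTriangleBuilding X) {q : ℕ} (hq : HasParameter X q) {b : Frame X}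
    {m : Measure (Omega0 b)} (hm : IsBoundaryMeasure b q m) :
    HoroSystem m q (fun i j ω => (horoChart hX b ω).emb (i, j)) (fun i j => Fil b (i, j)) := by
  have hq1 := one_le_of_hasParameter hq b.chart
  have hret : ∀ (ω : Omega0 b) (μ : Coweight), RetractsTo b ((horoChart hX b ω).emb μ) μ :=
    fun ω μ => retractsTo_iff.2 ⟨_, isHoro_horoChart hX b ω, rfl⟩
  have hmono : ∀ {ω ω' : Omega0 b} {i j a c : ℤ},
      (horoChart hX b ω').emb (a, c) = (horoChart hX b ω).emb (a, c) → i ≤ a → j ≤ c →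
      (horoChart hX b ω').emb (i, j) = (horoChart hX b ω).emb (i, j) := by
    intro ω ω' i j a c h hi hj
    obtain ⟨n, hn⟩ := (isHoro_horoChart hX b ω').exists_agree (isHoro_horoChart hX b ω)
    exact emb_eq_of_le hX hn h hi hj
  have hcard : ∀ (ω : Omega0 b) {u v w : Coweight}, Tri u v w → {x | ∃ ω' : Omega0 b,
      (horoChart hX b ω').emb u = (horoChart hX b ω).emb u ∧
      (horoChart hX b ω').emb v = (horoChart hX b ω).emb v ∧
      (horoChart hX b ω').emb w = (horoChart hX b ω).emb w ∧
      (horoChart hX b ω').emb (u + v - w) = x}.encard ≤ q := by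
    intro ω u v w ht
    refine le_trans (Set.encard_le_encard ?_) (encard_across_panel_le hq (horoChart hX b ω) ht)
    rintro x ⟨ω', h1, h2, h3, h4⟩
    exact ⟨_, ⟨ht, h1.symm, h2.symm, h3.symm⟩, h4⟩
  refine ⟨hq1, fun i j => Fil_le b _, fun i j => ?_, fun i j ω => ?_, fun ω ω' => ?_, hmono,
    emb_eq_across_wall_zero hX, emb_eq_across_wall_one hX, emb_eq_across_wall_two hX,
    fun ω i j => ?_, fun ω i j => ?_, fun ω i j => ?_, ?_⟩
  · refine congrArg MeasurableSpace.generateFrom (Set.ext fun s => ?_)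
    constructor
    · rintro ⟨x, hx, rfl⟩
      -- Positive mass shows that some apartment [ω, ω₀] contains `x`, so that E_x is the atom of
      -- such an ω.
      have hpos : m (E b x) ≠ 0 := by
        rw [hm _ _ hx]
        exact (ENNReal.zpow_pos (by exact_mod_cast (by omega : q ≠ 0))
          (ENNReal.natCast_ne_top q) _).ne'
      rw [E_eq hX hx] at hpos ⊢
      obtain ⟨ω, rfl⟩ := nonempty_of_measure_ne_zero hpos
      exact ⟨ω, rfl⟩
    · rintro ⟨ω, rfl⟩
      exact ⟨_, hret ω (i, j), (E_eq hX (hret ω (i, j))).symm⟩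
  · have := hm _ _ (hret ω (i, j))
    rwa [E_eq hX (hret ω (i, j))] at this
  · obtain ⟨n, hn⟩ := (isHoro_horoChart hX b ω').exists_agree (isHoro_horoChart hX b ω)
    exact ⟨n, hn n n le_rfl le_rfl⟩
  · have ht : Tri (i, j) (i + 1, j - 1) (i, j - 1) := by
      constructor <;> simp only [HexLe, ne_eq, Prod.ext_iff] <;> omega
    simpa using hcard ω ht
  · have ht : Tri (i, j) (i, j - 1) (i - 1, j) := by
      constructor <;> simp only [HexLe, ne_eq, Prod.ext_iff] <;> omega
    simpa using hcard ω ht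
  · have ht : Tri (i, j) (i - 1, j) (i, j - 1) := by
      constructor <;> simp only [HexLe, ne_eq, Prod.ext_iff] <;> omega
    simpa using hcard ω ht
  · intro ω₁ ω₂ ω₃ ω₄ i j h1 h2 h3 h4
    have e2 := hmono (i := i) (j := j) h1 (by omega) le_rfl
    have e3 := hmono (i := i) (j := j) h2 le_rfl (by omega)
    have e4 := hmono (i := i) (j := j) h4 le_rfl (by omega)
    exact link_no_four_circuit hX (Tri.add_smul i j) e2 e3 (e2.trans e4) h1 h2 h3 h4

end TriangleBuilding

namespace TriangleBuilding

/-! ### Partitions of a set of finite measure -/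

section Partition

variable {Ω V : Type*} [MeasurableSpace Ω] {m : Measure Ω} {g : Ω → V} {S : Set Ω}

theorem measure_le_of_encard_image_le {q : ℕ} {M : ℝ≥0∞} (hS : (g '' S).encard ≤ q)
    (hM : ∀ ω ∈ S, m (S ∩ {ω' | g ω' = g ω}) ≤ M) : m S ≤ q * M := by
  have hfin : (g '' S).Finite := Set.finite_of_encard_le_coe hS
  have hcard : hfin.toFinset.card ≤ q := by
    rw [hfin.encard_eq_coe_toFinset_card] at hS
    exact_mod_cast hS
  calc m S ≤ m (⋃ x ∈ hfin.toFinset, S ∩ {ω' | g ω' = x}) := measure_mono fun ω hω => by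
        simp only [Set.mem_iUnion]
        exact ⟨g ω, hfin.mem_toFinset.2 ⟨ω, hω, rfl⟩, hω, rfl⟩
    _ ≤ ∑ x ∈ hfin.toFinset, m (S ∩ {ω' | g ω' = x}) := measure_biUnion_finset_le _ _
    _ ≤ ∑ x ∈ hfin.toFinset, M := Finset.sum_le_sum fun x hx => by
        obtain ⟨ω, hω, rfl⟩ := hfin.mem_toFinset.1 hx
        exact hM ω hω
    _ ≤ q * M := by
        rw [Finset.sum_const, nsmul_eq_mul]
        gcongr

/-- If one of at most `q` pieces fell short of `M`, subadditivity would keep the total below `q *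
M`. This turns upper bounds on numbers of continuations into exact masses. -/
theorem measure_piece_eq_of_encard_image_le {q : ℕ} {M : ℝ≥0∞} (hMt : M ≠ ∞)
    (hS : (g '' S).encard ≤ q) (hM : ∀ ω ∈ S, m (S ∩ {ω' | g ω' = g ω}) ≤ M)
    (hm : m S = q * M) {ω : Ω} (hω : ω ∈ S) : m (S ∩ {ω' | g ω' = g ω}) = M := by
  classical
  refine le_antisymm (hM ω hω) ?_
  have hfin : (g '' S).Finite := Set.finite_of_encard_le_coe hS
  have hcard : hfin.toFinset.card ≤ q := by
    rw [hfin.encard_eq_coe_toFinset_card] at hS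
    exact_mod_cast hS
  have hmem : g ω ∈ hfin.toFinset := hfin.mem_toFinset.2 ⟨ω, hω, rfl⟩
  have hpos : 0 < hfin.toFinset.card := Finset.card_pos.2 ⟨_, hmem⟩
  obtain ⟨p, rfl⟩ : ∃ p, q = p + 1 := ⟨q - 1, by omega⟩
  have h1 : m S ≤ m (S ∩ {ω' | g ω' = g ω}) + p * M := calc
    m S ≤ m (⋃ x ∈ hfin.toFinset, S ∩ {ω' | g ω' = x}) := measure_mono fun ω hω => by
        simp only [Set.mem_iUnion]
        exact ⟨g ω, hfin.mem_toFinset.2 ⟨ω, hω, rfl⟩, hω, rfl⟩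
    _ ≤ ∑ x ∈ hfin.toFinset, m (S ∩ {ω' | g ω' = x}) := measure_biUnion_finset_le _ _
    _ = m (S ∩ {ω' | g ω' = g ω}) + ∑ x ∈ hfin.toFinset.erase (g ω), m (S ∩ {ω' | g ω' = x}) :=
        (Finset.add_sum_erase _ _ hmem).symm
    _ ≤ m (S ∩ {ω' | g ω' = g ω}) + ∑ x ∈ hfin.toFinset.erase (g ω), M := by
        gcongr with x hx
        obtain ⟨ω, hω, rfl⟩ := hfin.mem_toFinset.1 (Finset.mem_of_mem_erase hx)
        exact hM ω hω
    _ ≤ _ := by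
        rw [Finset.sum_const, nsmul_eq_mul, Finset.card_erase_of_mem hmem]
        gcongr
        omega
  rw [hm, Nat.cast_succ, add_mul, one_mul, add_comm] at h1
  exact (ENNReal.add_le_add_iff_right (ENNReal.mul_ne_top (ENNReal.natCast_ne_top p) hMt)).1 h1

/-- `g` takes finitely many values on `S`, all on pieces of the same positive finite measure. -/
structure UniformOn (m : Measure Ω) (g : Ω → V) (S : Set Ω) (N : ℝ≥0∞) : Prop where
  meas : ∀ ω ∈ S, MeasurableSet (S ∩ {ω' | g ω' = g ω})
  eq : ∀ ω ∈ S, m (S ∩ {ω' | g ω' = g ω}) = N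
  ne_zero : N ≠ 0
  lt_top : m S ≠ ∞

theorem UniformOn.sum_le {N : ℝ≥0∞} (h : UniformOn m g S N) {T : Finset V} (hT : ↑T ⊆ g '' S) :
    T.card * N ≤ m S := by
  have h1 : m (⋃ x ∈ T, S ∩ {ω' | g ω' = x}) = ∑ x ∈ T, m (S ∩ {ω' | g ω' = x}) := by
    refine measure_biUnion_finset ?_ ?_
    · intro x _ y _ hxy
      refine Set.disjoint_left.2 fun ω h1 h2 => hxy ?_
      exact h1.2.symm.trans h2.2
    · intro x hx
      obtain ⟨ω, hω, rfl⟩ := hT hx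
      exact h.meas ω hω
  have h2 : ∑ x ∈ T, m (S ∩ {ω' | g ω' = x}) = T.card * N := by
    rw [← nsmul_eq_mul, ← Finset.sum_const]
    refine Finset.sum_congr rfl fun x hx => ?_
    obtain ⟨ω, hω, rfl⟩ := hT hx
    exact h.eq ω hω
  rw [← h2, ← h1]
  exact measure_mono (Set.iUnion₂_subset fun x _ => Set.inter_subset_left)

theorem UniformOn.finite {N : ℝ≥0∞} (h : UniformOn m g S N) : (g '' S).Finite := by
  by_contra hinf
  obtain ⟨n, hn⟩ := ENNReal.exists_nat_mul_gt h.ne_zero h.lt_top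
  obtain ⟨T, hT, hc⟩ := Set.Infinite.exists_subset_card_eq hinf n
  have := h.sum_le hT
  rw [hc] at this
  exact absurd this (not_le.2 hn)

/-- The finite set of the values of `g` on `S`. -/
noncomputable def UniformOn.values {N : ℝ≥0∞} (h : UniformOn m g S N) : Finset V :=
  h.finite.toFinset

theorem UniformOn.mem_values {N : ℝ≥0∞} (h : UniformOn m g S N) {x : V} :
    x ∈ h.values ↔ ∃ ω ∈ S, g ω = x := by
  simp [UniformOn.values]

theorem UniformOn.card_mul {N : ℝ≥0∞} (h : UniformOn m g S N) : h.values.card * N = m S := by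
  refine le_antisymm (h.sum_le (by simp [UniformOn.values])) ?_
  refine measure_le_of_encard_image_le ?_ fun ω hω => (h.eq ω hω).le
  rw [h.finite.encard_eq_coe_toFinset_card]
  rfl

end Partition

/-! ### The measures of cells -/

section Cells

variable {Ω V : Type*}

/-- The atom of `ω` in the `σ`-field generated by `Y i j`. -/
def atom (Y : ℤ → ℤ → Ω → V) (i j : ℤ) (ω : Ω) : Set Ω := {ω' | Y i j ω' = Y i j ω}

/-- The set of all `ω'` that agree with `ω` on a truncated sector. -/
def cell (Y : ℤ → ℤ → Ω → V) (a b c : ℤ) (ω : Ω) : Set Ω :=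
  {ω' | ∀ i j, i ≤ a → j ≤ b → i + j ≤ c → Y i j ω' = Y i j ω}

theorem mem_cell_self (Y : ℤ → ℤ → Ω → V) (a b c : ℤ) (ω : Ω) : ω ∈ cell Y a b c ω :=
  fun _ _ _ _ _ => rfl

theorem atom_congr {Y : ℤ → ℤ → Ω → V} {i j : ℤ} {ω ω' : Ω} (h : ω' ∈ atom Y i j ω) :
    atom Y i j ω' = atom Y i j ω := by
  have h' : Y i j ω' = Y i j ω := h
  simp only [atom, h']

theorem cell_congr {Y : ℤ → ℤ → Ω → V} {a b c : ℤ} {ω ω' : Ω} (h : ω' ∈ cell Y a b c ω) :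
    cell Y a b c ω' = cell Y a b c ω := by
  ext ω''
  exact ⟨fun h' i j h1 h2 h3 => (h' i j h1 h2 h3).trans (h i j h1 h2 h3),
    fun h' i j h1 h2 h3 => (h' i j h1 h2 h3).trans (h i j h1 h2 h3).symm⟩

variable [mΩ : MeasurableSpace Ω] {m : Measure Ω} {q : ℕ}
  {Y : ℤ → ℤ → Ω → V} {F : ℤ → ℤ → MeasurableSpace Ω}

theorem HoroSystem.measurableSet_atom_F (h : HoroSystem m q Y F) (i j : ℤ) (ω : Ω) :
    MeasurableSet[F i j] (atom Y i j ω) := by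
  rw [h.gen]
  exact MeasurableSpace.measurableSet_generateFrom ⟨ω, rfl⟩

theorem HoroSystem.measurableSet_atom (h : HoroSystem m q Y F) (i j : ℤ) (ω : Ω) :
    MeasurableSet (atom Y i j ω) := h.le i j _ (h.measurableSet_atom_F i j ω)

theorem HoroSystem.qpow_ne_zero (h : HoroSystem m q Y F) (n : ℤ) : (q : ℝ≥0∞) ^ n ≠ 0 :=
  (ENNReal.zpow_pos (by exact_mod_cast (by have := h.one_le; omega : q ≠ 0))
    (ENNReal.natCast_ne_top q) _).ne'

theorem HoroSystem.qpow_ne_top (h : HoroSystem m q Y F) (n : ℤ) : (q : ℝ≥0∞) ^ n ≠ ∞ :=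
  ENNReal.zpow_ne_top (by exact_mod_cast (by have := h.one_le; omega : q ≠ 0))
    (ENNReal.natCast_ne_top q) _

theorem HoroSystem.qpow_add (h : HoroSystem m q Y F) (n k : ℤ) :
    (q : ℝ≥0∞) ^ (n + k) = (q : ℝ≥0∞) ^ n * (q : ℝ≥0∞) ^ k :=
  ENNReal.zpow_add (by exact_mod_cast (by have := h.one_le; omega : q ≠ 0))
    (ENNReal.natCast_ne_top q) _ _

theorem HoroSystem.q_mul_qpow (h : HoroSystem m q Y F) (n : ℤ) :
    q * (q : ℝ≥0∞) ^ n = (q : ℝ≥0∞) ^ (n + 1) := by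
  rw [h.qpow_add, zpow_one, mul_comm]

theorem HoroSystem.measure_atom (h : HoroSystem m q Y F) (i j : ℤ) (ω : Ω) :
    m (atom Y i j ω) = (q : ℝ≥0∞) ^ (-2 * (i + j)) := h.meas i j ω

theorem HoroSystem.cell_eq_atom (h : HoroSystem m q Y F) {a b c : ℤ} (hc : a + b ≤ c) (ω : Ω) :
    cell Y a b c ω = atom Y a b ω := by
  ext ω'
  exact ⟨fun h' => h' a b le_rfl le_rfl hc, fun h' i j hi hj _ => h.mono h' hi hj⟩

/-- Agreement below y is carried towards x one column at a time across walls of α₁. Each crossing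
produces a vertex on the same level i + j, whence the truncation at y₁ + y₂. -/
theorem HoroSystem.mem_cell_of_agree (h : HoroSystem m q Y F) {x₁ x₂ y₁ y₂ : ℤ} {ω ω' : Ω}
    (hx : Y x₁ x₂ ω' = Y x₁ x₂ ω) (hy : Y y₁ y₂ ω' = Y y₁ y₂ ω) (h1 : y₁ ≤ x₁) :
    ω' ∈ cell Y x₁ y₂ (y₁ + y₂) ω := by
  have key : ∀ n : ℕ, y₁ + n ≤ x₁ → ω' ∈ cell Y (y₁ + n) y₂ (y₁ + y₂) ω := fun n => by
    induction n with
    | zero =>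
      intro _
      rw [h.cell_eq_atom (by simp)]
      simpa using (show ω' ∈ atom Y y₁ y₂ ω from hy)
    | succ n ih =>
      intro hn
      push_cast at hn
      have ih := ih (by omega)
      intro i j hi hj hij
      push_cast at hi
      rcases (show i ≤ y₁ + n ∨ i = y₁ + n + 1 by omega) with h3 | rfl
      · exact ih i j h3 hj hij
      have := h.conv1 (i := y₁ + n) (j := j + 1) (ih _ _ le_rfl (by omega) (by omega))
        (ih _ _ le_rfl (by omega) (by omega)) (ih _ _ (by omega) (by omega) (by omega)) hx
        (by omega)
      simpa using this
  have := key (x₁ - y₁).toNat (by omega)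
  rwa [show y₁ + ((x₁ - y₁).toNat : ℤ) = x₁ by omega] at this

/-- The hull of two sectors. -/
theorem HoroSystem.atom_inter_atom (h : HoroSystem m q Y F) {x₁ x₂ y₁ y₂ : ℤ} (h1 : y₁ ≤ x₁)
    (h2 : x₂ ≤ y₂) (ω : Ω) : atom Y x₁ x₂ ω ∩ atom Y y₁ y₂ ω =
      cell Y x₁ y₂ (max (x₁ + x₂) (y₁ + y₂)) ω := by
  ext ω'
  constructor
  · rintro ⟨hx, hy⟩
    rcases le_total (x₁ + x₂) (y₁ + y₂) with hl | hl
    · rw [max_eq_right hl]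
      exact h.mem_cell_of_agree hx hy h1
    · rw [max_eq_left hl]
      have := h.swap.mem_cell_of_agree (x₁ := y₂) (x₂ := y₁) (y₁ := x₂) (y₂ := x₁) hy hx h2
      exact fun i j hi hj hij => this j i hj hi (by omega)
  · intro hω
    exact ⟨hω _ _ le_rfl h2 (le_max_left _ _), hω _ _ h1 le_rfl (le_max_right _ _)⟩

/-- Induction on a + b - c. One further vertex on level c + 1 takes at most `q` values, and by
convexity across walls of α₀ it determines the whole level within the cell. -/
theorem HoroSystem.measure_cell_le (h : HoroSystem m q Y F) (n : ℕ) : ∀ {a b c : ℤ},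
    c + n = a + b → ∀ ω, m (cell Y a b c ω) ≤ (q : ℝ≥0∞) ^ (-(a + b + c)) := by
  induction n with
  | zero =>
    intro a b c hn ω
    rw [h.cell_eq_atom (by simp at hn; omega), h.measure_atom]
    refine le_of_eq (congrArg _ ?_)
    simp at hn; omega
  | succ n ih =>
    intro a b c hn ω
    push_cast at hn
    rw [show -(a + b + c) = -(a + b + (c + 1)) + 1 by ring, ← h.q_mul_qpow]
    refine measure_le_of_encard_image_le (g := Y a (c + 1 - a)) ?_ ?_
    · refine le_trans (Set.encard_le_encard ?_) (h.card0 ω (a - 1) (c + 1 - a))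
      rintro _ ⟨ω', hω', rfl⟩
      exact ⟨ω', hω' _ _ (by omega) (by omega) (by omega), hω' _ _ (by omega) (by omega) (by omega),
        hω' _ _ (by omega) (by omega) (by omega), by simp⟩
    · intro ω' hω'
      refine le_trans (measure_mono ?_) (ih (a := a) (b := b) (c := c + 1) (by omega) ω')
      rintro ω'' ⟨h1, h2⟩
      rw [← cell_congr hω'] at h1
      intro i j hi hj hij
      rcases (show i + j ≤ c ∨ i + j = c + 1 by omega) with h3 | h3
      · exact h1 i j hi hj h3
      have h2 : Y a (c + 1 - a) ω'' = Y a (c + 1 - a) ω' := h2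
      have := h.conv0 (i := i - 1) (j := j) (h1 _ _ (by omega) (by omega) (by omega))
        (h1 _ _ (by omega) (by omega) (by omega)) (h1 _ _ (by omega) (by omega) (by omega)) h2
        (by omega)
      simpa using this

/-- Starting from the atom at (a, c - a), let b grow. Each cell splits into at most `q` pieces, and
`measure_cell_le` bounds each by a q-th part of the whole; so all these bounds are attained. -/
theorem HoroSystem.measure_cell_aux (h : HoroSystem m q Y F) (n : ℕ) : ∀ {a b c : ℤ},
    b = c - a + n → ∀ ω, m (cell Y a b c ω) = (q : ℝ≥0∞) ^ (-(a + b + c)) := by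
  induction n with
  | zero =>
    intro a b c hn ω
    rw [h.cell_eq_atom (by simp at hn; omega), h.measure_atom]
    refine congrArg _ ?_
    simp at hn; omega
  | succ n ih =>
    intro a b c hn ω
    push_cast at hn
    have hsub : ∀ ω', cell Y a (b - 1) c ω' ∩ {ω'' | Y (c - b) b ω'' = Y (c - b) b ω'} =
        cell Y a b c ω' := fun ω' => by
      ext ω''
      constructor
      · rintro ⟨h1, h2⟩ i j hi hj hij
        rcases (show j ≤ b - 1 ∨ j = b by omega) with h3 | rfl
        · exact h1 i j hi h3 hij
        have h2 : Y (c - j) j ω'' = Y (c - j) j ω' := h2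
        have := h.conv2 (i := i + 1) (j := j - 1) (h1 _ _ (by omega) (by omega) (by omega))
          (h1 _ _ (by omega) (by omega) (by omega)) (h1 _ _ (by omega) (by omega) (by omega)) h2
          (by omega)
        simpa using this
      · intro h1
        exact ⟨fun i j hi hj hij => h1 i j hi (by omega) hij, h1 _ _ (by omega) le_rfl (by omega)⟩
    have := measure_piece_eq_of_encard_image_le (m := m) (g := Y (c - b) b)
      (S := cell Y a (b - 1) c ω) (q := q) (h.qpow_ne_top (-(a + b + c))) ?_ ?_ ?_
      (mem_cell_self Y a (b - 1) c ω)
    · rwa [hsub] at this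
    · refine le_trans (Set.encard_le_encard ?_) (h.card2 ω (c - b + 1) (b - 1))
      rintro _ ⟨ω', hω', rfl⟩
      exact ⟨ω', hω' _ _ (by omega) (by omega) (by omega), hω' _ _ (by omega) (by omega) (by omega),
        hω' _ _ (by omega) (by omega) (by omega), by simp⟩
    · intro ω' hω'
      rw [← cell_congr hω', hsub]
      exact h.measure_cell_le (n + 1) (by push_cast; omega) ω'
    · rw [ih (by omega), h.q_mul_qpow]
      congr 1
      ring

/-- The measure of a cell. -/
theorem HoroSystem.measure_cell (h : HoroSystem m q Y F) {a b c : ℤ} (hc : c ≤ a + b) (ω : Ω) :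
    m (cell Y a b c ω) = (q : ℝ≥0∞) ^ (-(a + b + c)) :=
  h.measure_cell_aux (b - (c - a)).toNat (by omega) ω

theorem HoroSystem.measure_atom_inter_atom (h : HoroSystem m q Y F) {x₁ x₂ y₁ y₂ : ℤ}
    (h1 : y₁ ≤ x₁) (h2 : x₂ ≤ y₂) (ω : Ω) : m (atom Y x₁ x₂ ω ∩ atom Y y₁ y₂ ω) =
      (q : ℝ≥0∞) ^ (-(x₁ + y₂ + max (x₁ + x₂) (y₁ + y₂))) := by
  rw [h.atom_inter_atom h1 h2, h.measure_cell (by omega)]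

end Cells

end TriangleBuilding

namespace TriangleBuilding

/-! ### A finite inequality -/

section Plane

open Finset

variable {α β γ 𝕜 : Type*} [RCLike 𝕜] [DecidableEq α] [DecidableEq γ] {X : Finset α} {Z : Finset β}
  {R : α → β → Prop} [∀ x z, Decidable (R x z)] {bl : α → γ} {q : ℕ}

/-- Double counting. Points of different blocks have at most one common line, and the `q` lines
through `x` carry q - 1 points each outside its block. As there are q² - q such points, every count
is one. -/
theorem card_common_eq_one (h1 : ∀ x ∈ X, #{z ∈ Z | R x z} = q)
    (h2 : ∀ z ∈ Z, ∀ x ∈ X, ∀ x' ∈ X, R x z → R x' z → bl x = bl x' → x = x')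
    (h3 : ∀ x ∈ X, ∀ x' ∈ X, ∀ z ∈ Z, ∀ z' ∈ Z, R x z → R x' z → R x z' → R x' z' →
      x = x' ∨ z = z')
    (h4 : ∀ z ∈ Z, #{x ∈ X | R x z} = q) (h5 : #X = q ^ 2)
    (h6 : ∀ x ∈ X, #{x' ∈ X | bl x' = bl x} = q) {x x' : α} (hx : x ∈ X) (hx' : x' ∈ X)
    (hb : bl x' ≠ bl x) : #{z ∈ Z | R x z ∧ R x' z} = 1 := by
  have hle : ∀ y ∈ X.filter (fun y => bl y ≠ bl x), #{z ∈ Z | R x z ∧ R y z} ≤ 1 := by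
    intro y hy
    rw [mem_filter] at hy
    refine card_le_one.2 fun z hz z' hz' => ?_
    rw [mem_filter] at hz hz'
    refine (h3 x hx y hy.1 z hz.1 z' hz'.1 hz.2.1 hz.2.2 hz'.2.1 hz'.2.2).resolve_left ?_
    rintro rfl
    exact hy.2 rfl
  have hsum : ∑ y ∈ X.filter (fun y => bl y ≠ bl x), #{z ∈ Z | R x z ∧ R y z} =
      ∑ y ∈ X.filter (fun y => bl y ≠ bl x), 1 := by
    have e1 : ∑ y ∈ X.filter (fun y => bl y ≠ bl x), #{z ∈ Z | R x z ∧ R y z} =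
        ∑ z ∈ Z.filter (R x), #{y ∈ X.filter (fun y => bl y ≠ bl x) | R y z} := by
      simp_rw [← filter_filter]
      exact sum_card_bipartiteAbove_eq_sum_card_bipartiteBelow R
    have e2 : ∀ z ∈ Z.filter (R x), #{y ∈ X.filter (fun y => bl y ≠ bl x) | R y z} = q - 1 := by
      intro z hz
      rw [mem_filter] at hz
      rw [← h4 z hz.1, ← card_erase_of_mem (mem_filter.2 ⟨hx, hz.2⟩)]
      congr 1
      ext y
      simp only [mem_filter, mem_erase]
      constructor
      · rintro ⟨⟨hy, hby⟩, hr⟩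
        refine ⟨?_, hy, hr⟩
        rintro rfl
        exact hby rfl
      · rintro ⟨hne, hy, hr⟩
        exact ⟨⟨hy, fun hby => hne (h2 z hz.1 y hy x hx hr hz.2 hby)⟩, hr⟩
    rw [e1, sum_congr rfl e2, sum_const, h1 x hx, sum_const, smul_eq_mul, smul_eq_mul, mul_one]
    have := card_filter_add_card_filter_not (s := X) (fun y => bl y = bl x)
    rw [h6 x hx, h5] at this
    change q + #{y ∈ X | bl y ≠ bl x} = q ^ 2 at this
    have hq : q * (q - 1) + q = q ^ 2 := by
      cases q with
      | zero => rfl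
      | succ n => simp; ring
    omega
  exact (sum_eq_sum_iff_of_le hle).1 hsum x' (mem_filter.2 ⟨hx', hb⟩)

/-- The norm of the incidence operator between the points outside a line and the lines that avoid
a point of this line, in a projective plane of order `q`. -/
theorem sum_norm_sum_sq_le (h1 : ∀ x ∈ X, #{z ∈ Z | R x z} = q)
    (h2 : ∀ z ∈ Z, ∀ x ∈ X, ∀ x' ∈ X, R x z → R x' z → bl x = bl x' → x = x')
    (h3 : ∀ x ∈ X, ∀ x' ∈ X, ∀ z ∈ Z, ∀ z' ∈ Z, R x z → R x' z → R x z' → R x' z' →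
      x = x' ∨ z = z')
    (h4 : ∀ z ∈ Z, #{x ∈ X | R x z} = q) (h5 : #X = q ^ 2)
    (h6 : ∀ x ∈ X, #{x' ∈ X | bl x' = bl x} = q) {f : α → 𝕜} (hf : ∑ x ∈ X, f x = 0) :
    ∑ z ∈ Z, ‖∑ x ∈ X with R x z, f x‖ ^ 2 ≤ q * ∑ x ∈ X, ‖f x‖ ^ 2 := by
  -- With A the incidence matrix, J the all-one matrix and B the same-block matrix, A Aᵀ = qI + J -
  -- B, and J kills `f`.
  have key : ∀ x ∈ X, ∑ z ∈ Z with R x z, ∑ x' ∈ X with R x' z, f x' =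
      q * f x - ∑ x' ∈ X with bl x' = bl x, f x' := by
    intro x hx
    have e1 : ∑ z ∈ Z with R x z, ∑ x' ∈ X with R x' z, f x' =
        ∑ x' ∈ X, (#{z ∈ Z | R x z ∧ R x' z} : 𝕜) * f x' := by
      simp_rw [sum_filter (s := X)]
      rw [sum_comm]
      refine sum_congr rfl fun x' _ => ?_
      rw [← sum_filter, filter_filter, sum_const, nsmul_eq_mul]
    have e2 : ∀ x' ∈ X, (#{z ∈ Z | R x z ∧ R x' z} : 𝕜) * f x' =
        (if x' = x then (q : 𝕜) * f x else 0) + f x' - (if bl x' = bl x then f x' else 0) := by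
      intro x' hx'
      by_cases hxx : x' = x
      · subst hxx
        simp [h1 x' hx']
      by_cases hb : bl x' = bl x
      · have : #{z ∈ Z | R x z ∧ R x' z} = 0 := by
          refine card_eq_zero.2 (filter_eq_empty_iff.2 ?_)
          rintro z hz ⟨hr, hr'⟩
          exact hxx (h2 z hz x' hx' x hx hr' hr hb)
        simp [this, hxx, hb]
      · simp [card_common_eq_one h1 h2 h3 h4 h5 h6 hx hx' hb, hxx, hb]
    rw [e1, sum_congr rfl e2, sum_sub_distrib, sum_add_distrib, hf, sum_ite_eq' X x, if_pos hx,
      sum_filter, add_zero]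
  -- Pairing with `f` turns the B-term into a sum of squares over blocks, which can be dropped.
  have h7 : ((∑ z ∈ Z, ‖∑ x ∈ X with R x z, f x‖ ^ 2 : ℝ) : 𝕜) =
      q * ((∑ x ∈ X, ‖f x‖ ^ 2 : ℝ) : 𝕜) -
        ((∑ b ∈ X.image bl, ‖∑ x ∈ X with bl x = b, f x‖ ^ 2 : ℝ) : 𝕜) := by
    have e1 : ∀ z ∈ Z, ((‖∑ x ∈ X with R x z, f x‖ ^ 2 : ℝ) : 𝕜) =
        ∑ x ∈ X with R x z, (starRingEnd 𝕜) (f x) * ∑ x' ∈ X with R x' z, f x' := by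
      intro z _
      rw [RCLike.ofReal_pow, ← RCLike.conj_mul, map_sum, sum_mul]
    have e2 : ∀ b ∈ X.image bl, ((‖∑ x ∈ X with bl x = b, f x‖ ^ 2 : ℝ) : 𝕜) =
        ∑ x ∈ X with bl x = b, (starRingEnd 𝕜) (f x) * ∑ x' ∈ X with bl x' = bl x, f x' := by
      intro b _
      rw [RCLike.ofReal_pow, ← RCLike.conj_mul, map_sum, sum_mul]
      refine sum_congr rfl fun x hx => ?_
      rw [(mem_filter.1 hx).2]
    rw [RCLike.ofReal_sum, RCLike.ofReal_sum, RCLike.ofReal_sum, sum_congr rfl e1,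
      sum_congr rfl e2, sum_fiberwise_of_maps_to (fun x hx => mem_image_of_mem bl hx)]
    simp_rw [sum_filter (s := X)]
    rw [sum_comm]
    have e3 : ∀ x ∈ X, (∑ z ∈ Z, if R x z then (starRingEnd 𝕜) (f x) *
        (∑ x' ∈ X, if R x' z then f x' else 0) else 0) =
        q * ((‖f x‖ ^ 2 : ℝ) : 𝕜) -
          (starRingEnd 𝕜) (f x) * ∑ x' ∈ X, if bl x' = bl x then f x' else 0 := by
      intro x hx
      have := key x hx
      simp_rw [sum_filter (s := X)] at this
      rw [← sum_filter, ← mul_sum, this, mul_sub, RCLike.ofReal_pow, ← RCLike.conj_mul]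
      ring
    rw [sum_congr rfl e3, sum_sub_distrib, mul_sum]
  have h8 : ∑ z ∈ Z, ‖∑ x ∈ X with R x z, f x‖ ^ 2 = q * ∑ x ∈ X, ‖f x‖ ^ 2 -
      ∑ b ∈ X.image bl, ‖∑ x ∈ X with bl x = b, f x‖ ^ 2 := by
    refine RCLike.ofReal_injective (K := 𝕜) ?_
    rw [h7, RCLike.ofReal_sub, RCLike.ofReal_mul, RCLike.ofReal_natCast]
  rw [h8]
  have : 0 ≤ ∑ b ∈ X.image bl, ‖∑ x ∈ X with bl x = b, f x‖ ^ 2 :=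
    sum_nonneg fun _ _ => by positivity
  linarith

end Plane

end TriangleBuilding

namespace TriangleBuilding

/-! ### Conditional expectations in `L²` -/

section Proj

variable {Ω 𝕜 : Type*} [RCLike 𝕜] {G G' : MeasurableSpace Ω} {mΩ : MeasurableSpace Ω}
  {m : Measure Ω}

/-- The conditional expectation as an operator of `L²`. -/
noncomputable def proj (hG : G ≤ mΩ) : Lp 𝕜 2 m →L[𝕜] Lp 𝕜 2 m :=
  (lpMeas 𝕜 𝕜 G 2 m).subtypeL.comp (condExpL2 𝕜 𝕜 hG)

theorem proj_eq_starProjection (hG : G ≤ mΩ) (f : Lp 𝕜 2 m) :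
    haveI : Fact (G ≤ mΩ) := ⟨hG⟩
    proj hG f = (lpMeas 𝕜 𝕜 G 2 m).starProjection f := rfl

theorem proj_mem (hG : G ≤ mΩ) (f : Lp 𝕜 2 m) : proj hG f ∈ lpMeas 𝕜 𝕜 G 2 m :=
  (condExpL2 𝕜 𝕜 hG f).2

theorem proj_of_mem (hG : G ≤ mΩ) {f : Lp 𝕜 2 m} (hf : f ∈ lpMeas 𝕜 𝕜 G 2 m) :
    proj hG f = f := by
  have : Fact (G ≤ mΩ) := ⟨hG⟩
  rw [proj_eq_starProjection]
  exact Submodule.starProjection_eq_self_iff.2 hf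

theorem proj_proj (hG : G ≤ mΩ) (f : Lp 𝕜 2 m) : proj hG (proj hG f) = proj hG f :=
  proj_of_mem hG (proj_mem hG f)

theorem lpMeas_mono (hGG : G ≤ G') : lpMeas 𝕜 𝕜 G 2 m ≤ lpMeas 𝕜 𝕜 G' 2 m := fun f hf => by
  rw [mem_lpMeas_iff_aestronglyMeasurable] at hf ⊢
  exact hf.mono hGG

theorem proj_proj_of_le (hG : G ≤ mΩ) (hG' : G' ≤ mΩ) (hGG : G ≤ G') (f : Lp 𝕜 2 m) :
    proj hG (proj hG' f) = proj hG f := by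
  have : Fact (G ≤ mΩ) := ⟨hG⟩
  have : Fact (G' ≤ mΩ) := ⟨hG'⟩
  rw [← sub_eq_zero, ← map_sub, proj_eq_starProjection, Submodule.starProjection_apply_eq_zero_iff]
  rw [← neg_sub, neg_mem_iff]
  refine Submodule.orthogonal_le (lpMeas_mono hGG) ?_
  rw [proj_eq_starProjection]
  exact Submodule.sub_starProjection_mem_orthogonal f

theorem proj_proj_of_ge (hG : G ≤ mΩ) (hG' : G' ≤ mΩ) (hGG : G ≤ G') (f : Lp 𝕜 2 m) :
    proj hG' (proj hG f) = proj hG f :=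
  proj_of_mem hG' (lpMeas_mono hGG (proj_mem hG f))

theorem norm_proj_le (hG : G ≤ mΩ) (f : Lp 𝕜 2 m) : ‖proj hG f‖ ≤ ‖f‖ :=
  norm_condExpL2_coe_le hG f

theorem norm_sq_eq_proj (hG : G ≤ mΩ) (f : Lp 𝕜 2 m) :
    ‖f‖ ^ 2 = ‖f - proj hG f‖ ^ 2 + ‖proj hG f‖ ^ 2 := by
  have : Fact (G ≤ mΩ) := ⟨hG⟩
  have h1 := Submodule.norm_sq_eq_add_norm_sq_starProjection f (lpMeas 𝕜 𝕜 G 2 m)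
  rw [Submodule.starProjection_orthogonal_val, ← proj_eq_starProjection] at h1
  rw [h1, add_comm]

theorem setIntegral_proj (hG : G ≤ mΩ) (f : Lp 𝕜 2 m) {s : Set Ω} (hs : MeasurableSet[G] s)
    (hms : m s ≠ ∞) : ∫ ω in s, proj hG f ω ∂m = ∫ ω in s, f ω ∂m :=
  integral_condExpL2_eq (E' := 𝕜) (𝕜 := 𝕜) hG f hs hms

theorem Lp_two_integrableOn (f : Lp 𝕜 2 m) {s : Set Ω} (hs : m s ≠ ∞) : IntegrableOn f s m :=
  integrableOn_Lp_of_measure_ne_top f fact_one_le_two_ennreal.elim hs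

theorem ofReal_norm_sq_eq_lintegral (f : Lp 𝕜 2 m) :
    ENNReal.ofReal (‖f‖ ^ 2) = ∫⁻ ω, ‖f ω‖ₑ ^ 2 ∂m := by
  rw [ENNReal.ofReal_pow (norm_nonneg _), ofReal_norm, Lp.enorm_def,
    eLpNorm_eq_lintegral_rpow_enorm_toReal (by simp) (by simp)]
  rw [← ENNReal.rpow_natCast, ← ENNReal.rpow_mul]
  simp

end Proj

/-! ### Means over atoms -/

section Mean

variable {Ω V 𝕜 : Type*} [RCLike 𝕜] {mΩ : MeasurableSpace Ω} {m : Measure Ω} {g : Ω → V}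
  {S : Set Ω} {N : ℝ≥0∞}

/-- The mean of `f` over the fibre of `g` above `x`. -/
noncomputable def mean (m : Measure Ω) (g : Ω → V) (f : Ω → 𝕜) (x : V) : 𝕜 :=
  ((m {ω | g ω = x}).toReal : 𝕜)⁻¹ * ∫ ω in {ω | g ω = x}, f ω ∂m

theorem UniformOn.iUnion_eq (h : UniformOn m g S N) :
    S = ⋃ x ∈ h.values, S ∩ {ω | g ω = x} := by
  ext ω
  simp only [Set.mem_iUnion]
  constructor
  · intro hω
    exact ⟨g ω, h.mem_values.2 ⟨ω, hω, rfl⟩, hω, rfl⟩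
  · rintro ⟨_, _, hω, _⟩
    exact hω

theorem UniformOn.measurableSet_piece (h : UniformOn m g S N) {x : V} (hx : x ∈ h.values) :
    MeasurableSet (S ∩ {ω | g ω = x}) := by
  obtain ⟨ω, hω, rfl⟩ := h.mem_values.1 hx
  exact h.meas ω hω

theorem UniformOn.measure_piece (h : UniformOn m g S N) {x : V} (hx : x ∈ h.values) :
    m (S ∩ {ω | g ω = x}) = N := by
  obtain ⟨ω, hω, rfl⟩ := h.mem_values.1 hx
  exact h.eq ω hω

theorem UniformOn.pairwiseDisjoint (h : UniformOn m g S N) :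
    Set.PairwiseDisjoint (h.values : Set V) fun x => S ∩ {ω | g ω = x} :=
  fun _ _ _ _ hxy => Set.disjoint_left.2 fun _ h1 h2 => hxy (h1.2.symm.trans h2.2)

theorem UniformOn.measurableSet (h : UniformOn m g S N) : MeasurableSet S := by
  rw [h.iUnion_eq]
  exact Finset.measurableSet_biUnion _ fun x hx => h.measurableSet_piece hx

theorem UniformOn.lintegral_eq (h : UniformOn m g S N) (u : V → ℝ≥0∞) :
    ∫⁻ ω in S, u (g ω) ∂m = N * ∑ x ∈ h.values, u x := by
  conv_lhs => rw [h.iUnion_eq]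
  rw [lintegral_biUnion_finset h.pairwiseDisjoint fun x hx => h.measurableSet_piece hx,
    Finset.mul_sum]
  refine Finset.sum_congr rfl fun x hx => ?_
  rw [setLIntegral_congr_fun (g := fun _ => u x) (h.measurableSet_piece hx)
    (fun ω hω => by rw [hω.2]), setLIntegral_const, h.measure_piece hx, mul_comm]

theorem UniformOn.integral_eq_sum (h : UniformOn m g S N) {f : Ω → 𝕜} (hf : IntegrableOn f S m) :
    ∫ ω in S, f ω ∂m = ∑ x ∈ h.values, ∫ ω in S ∩ {ω | g ω = x}, f ω ∂m := by
  conv_lhs => rw [h.iUnion_eq]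
  exact integral_biUnion_finset _ (fun x hx => h.measurableSet_piece hx) h.pairwiseDisjoint
    fun x _ => hf.mono_set Set.inter_subset_left

theorem UniformOn.integral_eq (h : UniformOn m g S N) {u : V → 𝕜} {f : Ω → 𝕜}
    (hf : IntegrableOn f S m) (hu : ∀ᵐ ω ∂m, f ω = u (g ω)) :
    ∫ ω in S, f ω ∂m = (N.toReal : 𝕜) * ∑ x ∈ h.values, u x := by
  rw [h.integral_eq_sum hf, Finset.mul_sum]
  refine Finset.sum_congr rfl fun x hx => ?_
  rw [setIntegral_congr_ae (g := fun _ => u x) (h.measurableSet_piece hx)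
    (hu.mono fun ω h1 hω => by rw [h1, hω.2]), setIntegral_const, measureReal_def,
    h.measure_piece hx, RCLike.real_smul_eq_coe_mul]

end Mean

end TriangleBuilding

namespace TriangleBuilding

/-! ### The martingale of a horospherical system -/

section System

variable {Ω V 𝕜 : Type*} [RCLike 𝕜] [mΩ : MeasurableSpace Ω] {m : Measure Ω} {q : ℕ}
  {Y : ℤ → ℤ → Ω → V} {F : ℤ → ℤ → MeasurableSpace Ω}

theorem HoroSystem.measure_atom_ne_top (h : HoroSystem m q Y F) (i j : ℤ) (ω : Ω) :
    m (atom Y i j ω) ≠ ∞ := by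
  rw [h.measure_atom]
  exact h.qpow_ne_top _

theorem HoroSystem.uniformOn (h : HoroSystem m q Y F) {i j n : ℤ} {S : Set Ω}
    (hS : MeasurableSet S) (hfin : m S ≠ ∞)
    (hN : ∀ ω ∈ S, m (S ∩ atom Y i j ω) = (q : ℝ≥0∞) ^ n) :
    UniformOn m (Y i j) S ((q : ℝ≥0∞) ^ n) :=
  ⟨fun ω _ => hS.inter (h.measurableSet_atom i j ω), hN, h.qpow_ne_zero _, hfin⟩

theorem HoroSystem.atom_subset (h : HoroSystem m q Y F) {i j i' j' : ℤ} (hi : i' ≤ i) (hj : j' ≤ j)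
    (ω : Ω) : atom Y i j ω ⊆ atom Y i' j' ω := fun _ hω => h.mono hω hi hj

theorem HoroSystem.uniformOn_atom (h : HoroSystem m q Y F) {i j i' j' : ℤ} (hi : i' ≤ i)
    (hj : j' ≤ j) (ω : Ω) :
    UniformOn m (Y i j) (atom Y i' j' ω) ((q : ℝ≥0∞) ^ (-2 * (i + j))) := by
  refine h.uniformOn (h.measurableSet_atom _ _ _) (h.measure_atom_ne_top _ _ _) fun ω' hω' => ?_
  rw [← atom_congr hω', Set.inter_eq_right.2 (h.atom_subset hi hj ω'), h.measure_atom]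

/-- A coarse atom is a union of finitely many finer ones, because these have equal positive mass. -/
theorem HoroSystem.F_mono (h : HoroSystem m q Y F) {i j i' j' : ℤ} (hi : i' ≤ i) (hj : j' ≤ j) :
    F i' j' ≤ F i j := by
  rw [h.gen i' j']
  refine MeasurableSpace.generateFrom_le ?_
  rintro _ ⟨ω, rfl⟩
  have hU := h.uniformOn_atom hi hj ω
  change MeasurableSet[F i j] (atom Y i' j' ω)
  rw [hU.iUnion_eq]
  refine Finset.measurableSet_biUnion _ fun x hx => ?_
  obtain ⟨ω', hω', rfl⟩ := hU.mem_values.1 hx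
  change MeasurableSet[F i j] (atom Y i' j' ω ∩ atom Y i j ω')
  rw [← atom_congr hω', Set.inter_eq_right.2 (h.atom_subset hi hj ω')]
  exact h.measurableSet_atom_F i j ω'

theorem HoroSystem.mem_iff_of_measurableSet (h : HoroSystem m q Y F) {i j : ℤ} {s : Set Ω}
    (hs : MeasurableSet[F i j] s) {ω ω' : Ω} (hω : ω' ∈ atom Y i j ω) : ω' ∈ s ↔ ω ∈ s := by
  rw [h.gen] at hs
  have hω : Y i j ω' = Y i j ω := hω
  induction s, hs using MeasurableSpace.generateFrom_induction with
  | hC t ht _ =>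
    obtain ⟨ω'', rfl⟩ := ht
    change Y i j ω' = _ ↔ Y i j ω = _
    rw [hω]
  | empty => rfl
  | compl t _ ih => exact not_congr ih
  | iUnion s _ ih => simp [ih]

/-- The conditional expectation is the mean over the atoms. -/
theorem HoroSystem.proj_ae_eq (h : HoroSystem m q Y F) (i j : ℤ) (f : Lp 𝕜 2 m) :
    proj (h.le i j) f =ᵐ[m] fun ω => mean m (Y i j) f (Y i j ω) := by
  obtain ⟨g, hg, hfg⟩ := mem_lpMeas_iff_aestronglyMeasurable.1 (proj_mem (h.le i j) f)
  refine hfg.trans (Filter.Eventually.of_forall fun ω => ?_)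
  -- Sets of `F i j` are unions of atoms, so a measurable representative is constant on each atom;
  -- its value there is forced by the integral.
  have hconst : ∀ ω' ∈ atom Y i j ω, g ω' = g ω := fun ω' hω' =>
    (h.mem_iff_of_measurableSet (hg.measurable (measurableSet_singleton (g ω))) hω').2 rfl
  have e : ∫ ω' in atom Y i j ω, f ω' ∂m = (m (atom Y i j ω)).toReal * g ω := by
    rw [← setIntegral_proj (h.le i j) f (h.measurableSet_atom_F i j ω) (h.measure_atom_ne_top i j ω),
      setIntegral_congr_ae (g := fun _ => g ω) (h.measurableSet_atom i j ω)
      (hfg.mono fun ω' h1 hω' => h1.trans (hconst ω' hω')), setIntegral_const, measureReal_def,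
      RCLike.real_smul_eq_coe_mul]
  have hne : ((m (atom Y i j ω)).toReal : 𝕜) ≠ 0 := by
    rw [RCLike.ofReal_ne_zero, ENNReal.toReal_ne_zero, h.measure_atom]
    exact ⟨h.qpow_ne_zero _, h.qpow_ne_top _⟩
  change g ω = ((m (atom Y i j ω)).toReal : 𝕜)⁻¹ * ∫ ω' in atom Y i j ω, f ω' ∂m
  rw [e, inv_mul_cancel_left₀ hne]

theorem HoroSystem.proj_congr (h : HoroSystem m q Y F) {i j : ℤ} {f f' : Lp 𝕜 2 m}
    (hff : ∀ ω, ∫ ω' in atom Y i j ω, f ω' ∂m = ∫ ω' in atom Y i j ω, f' ω' ∂m) :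
    proj (h.le i j) f = proj (h.le i j) f' := by
  refine Lp.ext ((h.proj_ae_eq i j f).trans (Filter.EventuallyEq.trans ?_
    (h.proj_ae_eq i j f').symm))
  refine Filter.Eventually.of_forall fun ω => ?_
  exact congrArg _ (hff ω)

/-- Any two ω agree far enough towards ω₀, which exhibits the range as a countable union of finite
sets. Integrals can then be summed over atoms. -/
theorem HoroSystem.countable_range (h : HoroSystem m q Y F) (i j : ℤ) :
    (Set.range (Y i j)).Countable := by
  rcases isEmpty_or_nonempty Ω with hΩ | ⟨⟨ω⟩⟩
  · rw [Set.range_eq_empty]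
    exact Set.countable_empty
  have hsub : Set.range (Y i j) ⊆ ⋃ n : ℤ, Y i j '' atom Y (min i n) (min j n) ω := by
    rintro _ ⟨ω', rfl⟩
    obtain ⟨n, hn⟩ := h.start ω ω'
    refine Set.mem_iUnion.2 ⟨n, ω', ?_, rfl⟩
    exact h.mono hn (min_le_right _ _) (min_le_right _ _)
  refine (Set.countable_iUnion fun n => ?_).mono hsub
  exact (h.uniformOn_atom (min_le_left _ _) (min_le_left _ _) ω).finite.countable

theorem HoroSystem.lintegral_le_of_atoms (h : HoroSystem m q Y F) (i j : ℤ) {u v : Ω → ℝ≥0∞}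
    (huv : ∀ ω, ∫⁻ ω' in atom Y i j ω, u ω' ∂m ≤ ∫⁻ ω' in atom Y i j ω, v ω' ∂m) :
    ∫⁻ ω, u ω ∂m ≤ ∫⁻ ω, v ω ∂m := by
  have : Countable (Set.range (Y i j)) := (h.countable_range i j).to_subtype
  have hcov : (⋃ x : Set.range (Y i j), {ω | Y i j ω = x}) = Set.univ := by
    ext ω
    simp
  have hmeas : ∀ x : Set.range (Y i j), MeasurableSet {ω | Y i j ω = x} := by
    rintro ⟨_, ω, rfl⟩
    exact h.measurableSet_atom i j ω
  have hdisj : Pairwise (Function.onFun Disjoint fun x : Set.range (Y i j) => {ω | Y i j ω = x}) :=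
    fun x y hxy => Set.disjoint_left.2 fun ω h1 h2 => hxy (Subtype.ext (h1.symm.trans h2))
  rw [← setLIntegral_univ u, ← setLIntegral_univ v, ← hcov, lintegral_iUnion hmeas hdisj,
    lintegral_iUnion hmeas hdisj]
  refine ENNReal.tsum_le_tsum ?_
  rintro ⟨_, ω, rfl⟩
  exact huv ω

theorem HoroSystem.ae_eq_mean (h : HoroSystem m q Y F) {i j : ℤ} {f : Lp 𝕜 2 m}
    (hf : proj (h.le i j) f = f) : ∀ᵐ ω ∂m, f ω = mean m (Y i j) f (Y i j ω) := by
  have := h.proj_ae_eq i j f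
  rwa [hf] at this

/-- Conditional independence: given `Y b₁ b₂`, the vertex `Y a₁ a₂` takes the same number of values
whether `Y c₁ c₂` is given or not. -/
theorem HoroSystem.proj_proj_eq (h : HoroSystem m q Y F) {a₁ a₂ b₁ b₂ c₁ c₂ : ℤ} {n : ℕ}
    {N₁ N₂ N₃ : ℝ≥0∞} (hab : ∀ ω, UniformOn m (Y a₁ a₂) (atom Y b₁ b₂ ω) N₁)
    (hn₁ : ∀ ω, m (atom Y b₁ b₂ ω) = n * N₁)
    (habc : ∀ ω, UniformOn m (Y a₁ a₂) (atom Y b₁ b₂ ω ∩ atom Y c₁ c₂ ω) N₂)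
    (hn₂ : ∀ ω, m (atom Y b₁ b₂ ω ∩ atom Y c₁ c₂ ω) = n * N₂)
    (hbc : ∀ ω, UniformOn m (Y b₁ b₂) (atom Y c₁ c₂ ω) N₃)
    {f : Lp 𝕜 2 m} (hf : proj (h.le a₁ a₂) f = f) :
    proj (h.le c₁ c₂) (proj (h.le b₁ b₂) f) = proj (h.le c₁ c₂) f := by
  have hfm := h.ae_eq_mean hf
  refine h.proj_congr fun ω₀ => ?_
  rw [(hbc ω₀).integral_eq_sum (Lp_two_integrableOn _ (h.measure_atom_ne_top _ _ _)),
    (hbc ω₀).integral_eq_sum (Lp_two_integrableOn _ (h.measure_atom_ne_top _ _ _))]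
  refine Finset.sum_congr rfl fun x hx => ?_
  obtain ⟨ω, hω, rfl⟩ := (hbc ω₀).mem_values.1 hx
  have hT : atom Y c₁ c₂ ω₀ ∩ {ω' | Y b₁ b₂ ω' = Y b₁ b₂ ω} =
      atom Y b₁ b₂ ω ∩ atom Y c₁ c₂ ω := by
    rw [atom_congr hω, Set.inter_comm]
    rfl
  rw [hT]
  have hTfin : m (atom Y b₁ b₂ ω ∩ atom Y c₁ c₂ ω) ≠ ∞ := (habc ω).lt_top
  have hTmeas := (habc ω).measurableSet
  have hN₁ : N₁ ≠ 0 := (hab ω).ne_zero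
  have hb0 : m (atom Y b₁ b₂ ω) ≠ 0 := by
    rw [h.measure_atom]
    exact h.qpow_ne_zero _
  have hn0 : (n : ℝ≥0∞) ≠ 0 := by
    intro h0
    rw [hn₁ ω, h0, zero_mul] at hb0
    exact hb0 rfl
  have hN₁t : N₁ ≠ ∞ := by
    intro h0
    have := h.measure_atom_ne_top b₁ b₂ ω
    rw [hn₁ ω, h0, ENNReal.mul_top hn0] at this
    exact this rfl
  have hcard : ∀ {S : Set Ω} {N : ℝ≥0∞} (hU : UniformOn m (Y a₁ a₂) S N), m S = n * N →
      hU.values.card = n := by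
    intro S N hU hS
    have h1 := hU.card_mul
    have hNt : N ≠ ∞ := by
      intro h0
      have := hU.lt_top
      rw [hS, h0, ENNReal.mul_top hn0] at this
      exact this rfl
    rw [hS, ENNReal.mul_left_inj hU.ne_zero hNt] at h1
    exact_mod_cast h1
  -- The values on the smaller set are among those on the larger and are equally many. As all values
  -- have equal weight, `f` has the same mean over both sets.
  have hvals : (habc ω).values = (hab ω).values := by
    refine Finset.eq_of_subset_of_card_le (fun x hx => ?_) ?_
    · obtain ⟨ω', hω', rfl⟩ := (habc ω).mem_values.1 hx
      exact (hab ω).mem_values.2 ⟨ω', hω'.1, rfl⟩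
    · rw [hcard _ (hn₁ ω), hcard _ (hn₂ ω)]
  have e1 := (hab ω).integral_eq (Lp_two_integrableOn f (h.measure_atom_ne_top _ _ ω)) hfm
  have e2 := (habc ω).integral_eq (Lp_two_integrableOn f hTfin) hfm
  rw [e2, hvals]
  rw [setIntegral_congr_ae (g := fun _ => mean m (Y b₁ b₂) f (Y b₁ b₂ ω)) hTmeas
    ((h.proj_ae_eq b₁ b₂ f).mono fun ω' h1 hω' => h1.trans (congrArg _ hω'.1)),
    setIntegral_const, measureReal_def, RCLike.real_smul_eq_coe_mul, hn₂ ω]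
  change _ * (((m (atom Y b₁ b₂ ω)).toReal : 𝕜)⁻¹ * ∫ ω' in atom Y b₁ b₂ ω, f ω' ∂m) = _
  rw [e1, hn₁ ω, ENNReal.toReal_mul, ENNReal.toReal_mul]
  have h1 : ((n : ℝ≥0∞).toReal : 𝕜) ≠ 0 := by
    rw [RCLike.ofReal_ne_zero, ENNReal.toReal_ne_zero]
    exact ⟨hn0, ENNReal.natCast_ne_top n⟩
  have h2 : (N₁.toReal : 𝕜) ≠ 0 := by
    rw [RCLike.ofReal_ne_zero, ENNReal.toReal_ne_zero]
    exact ⟨hN₁, hN₁t⟩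
  push_cast
  field_simp

end System

end TriangleBuilding

/-! ### Decay along an edge and summation of the differences -/

namespace TriangleBuilding

section System

variable {Ω V 𝕜 : Type*} [RCLike 𝕜] [mΩ : MeasurableSpace Ω] {m : Measure Ω} {q : ℕ}
  {Y : ℤ → ℤ → Ω → V} {F : ℤ → ℤ → MeasurableSpace Ω}

theorem HoroSystem.qpow_eq_mul (h : HoroSystem m q Y F) {n k : ℤ} (hnk : n = k + 1) :
    (q : ℝ≥0∞) ^ n = q * (q : ℝ≥0∞) ^ k := by
  rw [hnk, h.q_mul_qpow]

theorem HoroSystem.qpow_eq_sq_mul (h : HoroSystem m q Y F) {n k : ℤ} (hnk : n = k + 2) :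
    (q : ℝ≥0∞) ^ n = (q ^ 2 : ℕ) * (q : ℝ≥0∞) ^ k := by
  rw [hnk, show k + 2 = k + 1 + 1 by ring, ← h.q_mul_qpow, ← h.q_mul_qpow]
  push_cast
  ring

/-- The values of a vertex on the atom of an incomparable one. -/
theorem HoroSystem.uniformOn_atom_of_le (h : HoroSystem m q Y F) {x₁ x₂ y₁ y₂ : ℤ} (h1 : y₁ ≤ x₁)
    (h2 : x₂ ≤ y₂) (ω : Ω) : UniformOn m (Y x₁ x₂) (atom Y y₁ y₂ ω)
      ((q : ℝ≥0∞) ^ (-(x₁ + y₂ + max (x₁ + x₂) (y₁ + y₂)))) := by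
  refine h.uniformOn (h.measurableSet_atom _ _ _) (h.measure_atom_ne_top _ _ _) fun ω' hω' => ?_
  rw [← atom_congr hω', Set.inter_comm, h.measure_atom_inter_atom h1 h2]

theorem HoroSystem.uniformOn_atom_of_ge (h : HoroSystem m q Y F) {x₁ x₂ y₁ y₂ : ℤ} (h1 : y₁ ≤ x₁)
    (h2 : x₂ ≤ y₂) (ω : Ω) : UniformOn m (Y y₁ y₂) (atom Y x₁ x₂ ω)
      ((q : ℝ≥0∞) ^ (-(x₁ + y₂ + max (x₁ + x₂) (y₁ + y₂)))) := by
  refine h.uniformOn (h.measurableSet_atom _ _ _) (h.measure_atom_ne_top _ _ _) fun ω' hω' => ?_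
  rw [← atom_congr hω', h.measure_atom_inter_atom h1 h2]

/-- The values of a vertex on an intersection of two atoms, one of which is determined by this
vertex and the other atom. -/
theorem HoroSystem.uniformOn_inter (h : HoroSystem m q Y F) {a₁ a₂ b₁ b₂ c₁ c₂ : ℤ}
    (hca : c₁ ≤ a₁) (hac : a₂ ≤ c₂) (hb₁ : b₁ ≤ a₁) (hb₂ : b₂ ≤ c₂)
    (hb : b₁ + b₂ ≤ max (a₁ + a₂) (c₁ + c₂)) (ω : Ω) :
    UniformOn m (Y a₁ a₂) (atom Y b₁ b₂ ω ∩ atom Y c₁ c₂ ω)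
      ((q : ℝ≥0∞) ^ (-(a₁ + c₂ + max (a₁ + a₂) (c₁ + c₂)))) := by
  refine h.uniformOn ((h.measurableSet_atom _ _ _).inter (h.measurableSet_atom _ _ _))
    (measure_ne_top_of_subset Set.inter_subset_left (h.measure_atom_ne_top b₁ b₂ ω))
    fun ω' hω' => ?_
  rw [← h.measure_atom_inter_atom hca hac ω', ← atom_congr hω'.1, ← atom_congr hω'.2]
  congr 1
  have hsub : atom Y a₁ a₂ ω' ∩ atom Y c₁ c₂ ω' ⊆ atom Y b₁ b₂ ω' := by
    rw [h.atom_inter_atom hca hac]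
    exact fun ω'' h' => h' _ _ hb₁ hb₂ hb
  ext ω''
  exact ⟨fun h' => ⟨h'.2, h'.1.2⟩, fun h' => ⟨⟨hsub h', h'.2⟩, h'.1⟩⟩

/-- The vertex (i-1, j+1) lies in the hull of (i, j) and the target, and given it there remain q
values of `Y i j`, whether or not the target is known. -/
theorem HoroSystem.proj_proj_edge (h : HoroSystem m q Y F) {i j : ℤ} {s t : ℕ}
    {f : Lp 𝕜 2 m} (hf : proj (h.le i j) f = f) :
    proj (h.le (i - 1 - s) (j + 1 + s + t)) (proj (h.le (i - 1) (j + 1)) f) =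
      proj (h.le (i - 1 - s) (j + 1 + s + t)) f := by
  refine h.proj_proj_eq (n := q) (h.uniformOn_atom_of_le (by omega) (by omega)) (fun ω => ?_)
    (h.uniformOn_inter (by omega) (by omega) (by omega) (by omega) (by omega)) (fun ω => ?_)
    (h.uniformOn_atom_of_le (by omega) (by omega)) hf
  · rw [h.measure_atom]
    exact h.qpow_eq_mul (by omega)
  · rw [Set.inter_comm, Set.inter_comm, h.measure_atom_inter_atom (by omega) (by omega)]
    exact h.qpow_eq_mul (by omega)

/-- The expectation factors through (i-1, j), which lies in the hull of (i, j) and (i-2, j+1); there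
are q² values of `Y i j` on either side of the comparison. -/
theorem HoroSystem.proj_eq_zero (h : HoroSystem m q Y F) {i j : ℤ} {f : Lp 𝕜 2 m}
    (hf : proj (h.le i j) f = f) (h0 : proj (h.le (i - 1) j) f = 0) :
    proj (h.le (i - 2) (j + 1)) f = 0 := by
  rw [← h.proj_proj_eq (n := q ^ 2) (b₁ := i - 1) (b₂ := j)
    (h.uniformOn_atom (by omega) le_rfl) (fun ω => ?_)
    (h.uniformOn_inter (by omega) (by omega) (by omega) (by omega) (by omega)) (fun ω => ?_)
    (h.uniformOn_atom_of_le (by omega) (by omega)) hf, h0, map_zero]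
  · rw [h.measure_atom]
    exact h.qpow_eq_sq_mul (by omega)
  · rw [h.measure_atom_inter_atom (by omega) (by omega)]
    exact h.qpow_eq_sq_mul (by omega)

theorem UniformOn.card_eq {g : Ω → V} {S : Set Ω} {N : ℝ≥0∞} {n : ℕ} (hU : UniformOn m g S N)
    (hn : n ≠ 0) (hS : m S = n * N) : hU.values.card = n := by
  have h1 := hU.card_mul
  have hNt : N ≠ ∞ := by
    intro h0
    have := hU.lt_top
    rw [hS, h0, ENNReal.mul_top (by exact_mod_cast hn)] at this
    exact this rfl
  rw [hS, ENNReal.mul_left_inj hU.ne_zero hNt] at h1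
  exact_mod_cast h1

/-- The estimate on the atoms of the vertex below the edge. -/
theorem HoroSystem.lintegral_proj_edge_le (h : HoroSystem m q Y F) {i j : ℤ} {f : Lp 𝕜 2 m}
    (hf : proj (h.le (i + 1) j) f = f) (h0 : proj (h.le i j) f = 0) (ω₀ : Ω) :
    q * ∫⁻ ω in atom Y i j ω₀, ‖proj (h.le i (j + 1)) f ω‖ₑ ^ 2 ∂m ≤
      ∫⁻ ω in atom Y i j ω₀, ‖f ω‖ₑ ^ 2 ∂m := by
  classical
  have hq0 : q ≠ 0 := by have := h.one_le; omega
  have hqR : (0 : ℝ) < q := by exact_mod_cast h.one_le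
  have hfm := h.ae_eq_mean hf
  have hA := h.uniformOn_atom (i := i + 1) (j := j) (i' := i) (j' := j) (by omega) le_rfl ω₀
  have hC := h.uniformOn_atom (i := i) (j := j + 1) (i' := i) (j' := j) le_rfl (by omega) ω₀
  rw [show -2 * (i + (j + 1)) = -2 * (i + 1 + j) by ring] at hC
  -- `M` is the mass of an atom at (i+1, j) or (i, j+1), and `N` that of the intersection of two
  -- such atoms, one of each kind, with a common point.
  set M := (q : ℝ≥0∞) ^ (-2 * (i + 1 + j)) with hM
  have hN : M = q * (q : ℝ≥0∞) ^ (-2 * (i + 1 + j) - 1) := h.qpow_eq_mul (by ring)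
  set N := (q : ℝ≥0∞) ^ (-2 * (i + 1 + j) - 1) with hN'
  have hNR : (N.toReal : 𝕜) ≠ 0 := by
    rw [RCLike.ofReal_ne_zero, ENNReal.toReal_ne_zero]
    exact ⟨h.qpow_ne_zero _, h.qpow_ne_top _⟩
  have hMR : (M.toReal : 𝕜) ≠ 0 := by
    rw [RCLike.ofReal_ne_zero, ENNReal.toReal_ne_zero]
    exact ⟨h.qpow_ne_zero _, h.qpow_ne_top _⟩
  have hAC : ∀ ω, UniformOn m (Y (i + 1) j) (atom Y i (j + 1) ω) N := fun ω => by
    have := h.uniformOn_atom_of_le (x₁ := i + 1) (x₂ := j) (y₁ := i) (y₂ := j + 1) (by omega)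
      (by omega) ω
    rwa [show -(i + 1 + (j + 1) + max (i + 1 + j) (i + (j + 1))) = -2 * (i + 1 + j) - 1 by omega]
      at this
  have hCA : ∀ ω, UniformOn m (Y i (j + 1)) (atom Y (i + 1) j ω) N := fun ω => by
    have := h.uniformOn_atom_of_ge (x₁ := i + 1) (x₂ := j) (y₁ := i) (y₂ := j + 1) (by omega)
      (by omega) ω
    rwa [show -(i + 1 + (j + 1) + max (i + 1 + j) (i + (j + 1))) = -2 * (i + 1 + j) - 1 by omega]
      at this
  have hmA : ∀ ω, m (atom Y (i + 1) j ω) = q * N := fun ω => by rw [h.measure_atom, ← hN]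
  have hmC : ∀ ω, m (atom Y i (j + 1) ω) = q * N := fun ω => by
    rw [h.measure_atom, ← hN, hM]
    congr 1
    ring
  have hB : ∀ ω, UniformOn m (Y (i + 1) j) (atom Y i j ω ∩ atom Y (i + 1) (j - 1) ω) M := fun ω => by
    refine h.uniformOn ((h.measurableSet_atom _ _ _).inter (h.measurableSet_atom _ _ _))
      (measure_ne_top_of_subset Set.inter_subset_left (h.measure_atom_ne_top i j ω))
      fun ω' hω' => ?_
    rw [← atom_congr hω'.1, ← atom_congr hω'.2, Set.inter_eq_right.2, h.measure_atom]
    exact Set.subset_inter (h.atom_subset (by omega) le_rfl ω')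
      (h.atom_subset le_rfl (by omega) ω')
  have hmB : ∀ ω, m (atom Y i j ω ∩ atom Y (i + 1) (j - 1) ω) = q * M := fun ω => by
    rw [Set.inter_comm, h.measure_atom_inter_atom (by omega) (by omega)]
    exact h.qpow_eq_mul (by omega)
  -- Points are values of `Y (i+1) j`, lines are values of `Y i (j+1)`; they are incident if they
  -- occur for a common ω. The vertex at (i+1, j-1) is a function of the point and labels its block;
  -- the singleton expresses it without a choice of ω.
  let R : V → V → Prop := fun x z => ∃ ω, Y (i + 1) j ω = x ∧ Y i (j + 1) ω = z
  let bl : V → Set V := fun x => {v | ∃ ω, Y (i + 1) j ω = x ∧ Y (i + 1) (j - 1) ω = v}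
  have hbl : ∀ ω ω', bl (Y (i + 1) j ω) = bl (Y (i + 1) j ω') ↔
      Y (i + 1) (j - 1) ω = Y (i + 1) (j - 1) ω' := by
    have e : ∀ ω, bl (Y (i + 1) j ω) = {Y (i + 1) (j - 1) ω} := fun ω => by
      ext v
      constructor
      · rintro ⟨ω', h1, rfl⟩
        exact h.mono h1 le_rfl (by omega)
      · rintro rfl
        exact ⟨ω, rfl, rfl⟩
    intro ω ω'
    rw [e, e, Set.singleton_eq_singleton_iff]
  have hRA : ∀ ω ∈ atom Y i j ω₀, {z ∈ hC.values | R (Y (i + 1) j ω) z} = (hCA ω).values := by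
    intro ω hω
    ext z
    rw [Finset.mem_filter, hC.mem_values, (hCA ω).mem_values]
    constructor
    · rintro ⟨-, ω', h1, h2⟩
      exact ⟨ω', h1, h2⟩
    · rintro ⟨ω', h1, h2⟩
      exact ⟨⟨ω', (h.mono h1 (by omega) le_rfl).trans hω, h2⟩, ω', h1, h2⟩
  have hRC : ∀ ω ∈ atom Y i j ω₀, {x ∈ hA.values | R x (Y i (j + 1) ω)} = (hAC ω).values := by
    intro ω hω
    ext z
    rw [Finset.mem_filter, hA.mem_values, (hAC ω).mem_values]
    constructor
    · rintro ⟨-, ω', h1, h2⟩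
      exact ⟨ω', h2, h1⟩
    · rintro ⟨ω', h1, h2⟩
      exact ⟨⟨ω', (h.mono h1 le_rfl (by omega)).trans hω, h2⟩, ω', h2, h1⟩
  have hsum : ∑ x ∈ hA.values, mean m (Y (i + 1) j) f x = 0 := by
    have e1 := hA.integral_eq (Lp_two_integrableOn f (h.measure_atom_ne_top _ _ ω₀)) hfm
    rw [← setIntegral_proj (h.le i j) f (h.measurableSet_atom_F i j ω₀)
      (h.measure_atom_ne_top i j ω₀), h0] at e1
    rw [integral_eq_zero_of_ae (ae_restrict_of_ae (Lp.coeFn_zero 𝕜 2 m))] at e1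
    exact (mul_eq_zero.1 e1.symm).resolve_left hMR
  have key := sum_norm_sum_sq_le (X := hA.values) (Z := hC.values) (R := R) (bl := bl) (q := q)
    (f := mean m (Y (i + 1) j) f) ?_ ?_ ?_ ?_ ?_ ?_ hsum
  · have hmean : ∀ z ∈ hC.values, mean m (Y i (j + 1)) f z =
        (q : 𝕜)⁻¹ * ∑ x ∈ hA.values with R x z, mean m (Y (i + 1) j) f x := by
      intro z hz
      obtain ⟨ω, hω, rfl⟩ := hC.mem_values.1 hz
      rw [hRC ω hω]
      have e1 := (hAC ω).integral_eq (Lp_two_integrableOn f (h.measure_atom_ne_top _ _ ω)) hfm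
      change ((m (atom Y i (j + 1) ω)).toReal : 𝕜)⁻¹ * ∫ ω' in atom Y i (j + 1) ω, f ω' ∂m = _
      rw [e1, hmC, ENNReal.toReal_mul, RCLike.ofReal_mul, ENNReal.toReal_natCast,
        RCLike.ofReal_natCast]
      have : (q : 𝕜) ≠ 0 := by exact_mod_cast hq0
      field_simp
    have l1 : ∫⁻ ω in atom Y i j ω₀, ‖proj (h.le i (j + 1)) f ω‖ₑ ^ 2 ∂m =
        ∫⁻ ω in atom Y i j ω₀, ‖mean m (Y i (j + 1)) f (Y i (j + 1) ω)‖ₑ ^ 2 ∂m :=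
      lintegral_congr_ae (ae_restrict_of_ae ((h.proj_ae_eq i (j + 1) f).mono fun ω hω => by
        simp only [hω]))
    have l2 : ∫⁻ ω in atom Y i j ω₀, ‖f ω‖ₑ ^ 2 ∂m =
        ∫⁻ ω in atom Y i j ω₀, ‖mean m (Y (i + 1) j) f (Y (i + 1) j ω)‖ₑ ^ 2 ∂m :=
      lintegral_congr_ae (ae_restrict_of_ae (hfm.mono fun ω hω => by simp only [← hω]))
    rw [l1, l2, hC.lintegral_eq (fun z => ‖mean m (Y i (j + 1)) f z‖ₑ ^ 2),
      hA.lintegral_eq (fun z => ‖mean m (Y (i + 1) j) f z‖ₑ ^ 2), mul_left_comm]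
    gcongr
    have conv : ∀ (T : Finset V) (u : V → 𝕜), ∑ x ∈ T, ‖u x‖ₑ ^ 2 =
        ENNReal.ofReal (∑ x ∈ T, ‖u x‖ ^ 2) := fun T u => by
      rw [ENNReal.ofReal_sum_of_nonneg fun _ _ => by positivity]
      refine Finset.sum_congr rfl fun x _ => ?_
      rw [ENNReal.ofReal_pow (norm_nonneg _), ofReal_norm]
    rw [conv, conv, ← ENNReal.ofReal_natCast, ← ENNReal.ofReal_mul (by positivity)]
    refine ENNReal.ofReal_le_ofReal ?_
    -- Averaging over q points contributes q⁻², the incidence operator q.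
    rw [Finset.sum_congr rfl fun z hz => by rw [hmean z hz, norm_mul, norm_inv,
      RCLike.norm_natCast, mul_pow], ← Finset.mul_sum]
    calc (q : ℝ) * ((q : ℝ)⁻¹ ^ 2 * _) = (q : ℝ)⁻¹ * _ := by field_simp
      _ ≤ (q : ℝ)⁻¹ * _ := mul_le_mul_of_nonneg_left key (by positivity)
      _ = _ := by field_simp
  · intro x hx
    obtain ⟨ω, hω, rfl⟩ := hA.mem_values.1 hx
    rw [hRA ω hω]
    exact (hCA ω).card_eq hq0 (hmA ω)
  -- A line meets a block at most once: (i+1, j) lies in the hull of (i+1, j-1) and (i, j+1).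
  · rintro z hz x hx x' hx' ⟨ω, rfl, rfl⟩ ⟨ω', rfl, h2⟩ hb
    rw [hbl] at hb
    have : ω' ∈ atom Y (i + 1) (j - 1) ω ∩ atom Y i (j + 1) ω := ⟨hb.symm, h2⟩
    rw [h.atom_inter_atom (by omega) (by omega)] at this
    exact (this _ _ le_rfl (by omega) (by omega)).symm
  · rintro x hx x' hx' z hz z' hz' ⟨ω₁, e1, e1'⟩ ⟨ω₃, e3, e3'⟩ ⟨ω₂, e2, e2'⟩ ⟨ω₄, e4, e4'⟩
    have := h.girth (ω₁ := ω₁) (ω₂ := ω₂) (ω₃ := ω₃) (ω₄ := ω₄) (i := i) (j := j)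
      (e1.trans e2.symm) (e1'.trans e3'.symm) (e3.trans e4.symm) (e2'.trans e4'.symm)
    rwa [e1, e3, e1', e2'] at this
  · intro z hz
    obtain ⟨ω, hω, rfl⟩ := hC.mem_values.1 hz
    rw [hRC ω hω]
    exact (hAC ω).card_eq hq0 (hmC ω)
  · refine hA.card_eq (pow_ne_zero 2 hq0) ?_
    rw [h.measure_atom]
    exact h.qpow_eq_sq_mul (by ring)
  · intro x hx
    obtain ⟨ω, hω, rfl⟩ := hA.mem_values.1 hx
    rw [← (hB ω).card_eq hq0 (hmB ω)]
    congr 1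
    ext y
    rw [Finset.mem_filter, hA.mem_values, (hB ω).mem_values]
    constructor
    · rintro ⟨⟨ω', h1, rfl⟩, h2⟩
      exact ⟨ω', ⟨h1.trans hω.symm, (hbl _ _).1 h2⟩, rfl⟩
    · rintro ⟨ω', h1, rfl⟩
      exact ⟨⟨ω', h1.1.trans hω, rfl⟩, (hbl _ _).2 h1.2⟩

theorem HoroSystem.proj_index (h : HoroSystem m q Y F) {i j i' j' : ℤ} (hi : i = i') (hj : j = j')
    (f : Lp 𝕜 2 m) : proj (h.le i j) f = proj (h.le i' j') f := by
  subst hi hj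
  rfl

theorem HoroSystem.norm_proj_edge_sq_le (h : HoroSystem m q Y F) {i j : ℤ} {f : Lp 𝕜 2 m}
    (hf : proj (h.le i j) f = f) (h0 : proj (h.le (i - 1) j) f = 0) :
    ‖proj (h.le (i - 1) (j + 1)) f‖ ^ 2 ≤ (q : ℝ)⁻¹ * ‖f‖ ^ 2 := by
  obtain ⟨i, rfl⟩ : ∃ k, i = k + 1 := ⟨i - 1, by ring⟩
  have e : i + 1 - 1 = i := by ring
  rw [h.proj_index e rfl] at h0 ⊢
  have hqR : (0 : ℝ) < q := by exact_mod_cast h.one_le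
  have h1 : q * ∫⁻ ω, ‖proj (h.le i (j + 1)) f ω‖ₑ ^ 2 ∂m ≤ ∫⁻ ω, ‖f ω‖ₑ ^ 2 ∂m := by
    rw [← lintegral_const_mul' _ _ (ENNReal.natCast_ne_top q)]
    refine h.lintegral_le_of_atoms i j fun ω => ?_
    rw [lintegral_const_mul' _ _ (ENNReal.natCast_ne_top q)]
    exact h.lintegral_proj_edge_le hf h0 ω
  rw [← ofReal_norm_sq_eq_lintegral, ← ofReal_norm_sq_eq_lintegral, ← ENNReal.ofReal_natCast,
    ← ENNReal.ofReal_mul hqR.le, ENNReal.ofReal_le_ofReal_iff (by positivity)] at h1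
  rwa [inv_mul_eq_div, le_div_iff₀ hqR, mul_comm]

/-- Differences of the martingale in the direction `λ₁` decay along the wall `λ₁ - λ₂`. -/
theorem HoroSystem.norm_proj_sq_le (h : HoroSystem m q Y F) (s t : ℕ) : ∀ {i j : ℤ} {f : Lp 𝕜 2 m},
    proj (h.le i j) f = f → proj (h.le (i - 1) j) f = 0 →
    ‖proj (h.le (i - s) (j + s + t)) f‖ ^ 2 ≤ (q : ℝ)⁻¹ ^ s * ‖f‖ ^ 2 := by
  induction s with
  | zero =>
    intro i j f _ _
    rw [pow_zero, one_mul]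
    exact pow_le_pow_left₀ (norm_nonneg _) (norm_proj_le _ f) 2
  | succ s ih =>
    intro i j f hf h0
    -- The projected function satisfies the hypothesis again, one edge further along λ₂ - λ₁, so the
    -- induction can continue.
    have h1 : proj (h.le (i - 1 - 1) (j + 1)) (proj (h.le (i - 1) (j + 1)) f) = 0 := by
      rw [proj_proj_of_le _ _ (h.F_mono (by omega) le_rfl)]
      rw [h.proj_index (show i - 1 - 1 = i - 2 by ring) rfl]
      exact h.proj_eq_zero hf h0
    have h2 := ih (proj_proj (h.le (i - 1) (j + 1)) f) h1
    rw [h.proj_proj_edge hf] at h2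
    have h3 := h.norm_proj_edge_sq_le hf h0
    rw [h.proj_index (show i - ((s + 1 : ℕ) : ℤ) = i - 1 - s by push_cast; ring)
      (show j + ((s + 1 : ℕ) : ℤ) + t = j + 1 + s + t by push_cast; ring)]
    refine h2.trans ?_
    rw [pow_succ (q : ℝ)⁻¹ s, mul_assoc]
    gcongr

/-- Cauchy–Schwarz for two terms, obtained from x²y² ≤ (aB)(bA) and the inequality of the means. -/
theorem add_sq_le_of_sq_le {x y a b A B : ℝ} (ha : 0 ≤ a) (hb : 0 ≤ b) (hA : 0 ≤ A) (hB : 0 ≤ B)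
    (hx : x ^ 2 ≤ a * A) (hy : y ^ 2 ≤ b * B) : (x + y) ^ 2 ≤ (a + b) * (A + B) := by
  have h1 : 2 * (x * y) ≤ a * B + b * A := by
    refine le_of_sq_le_sq ?_ (by positivity)
    have h2 : x ^ 2 * y ^ 2 ≤ a * A * (b * B) := by gcongr
    nlinarith [sq_nonneg (a * B - b * A)]
  nlinarith

/-- Peel off the difference `f - f'`, where `f'` is the expectation of `f` at (i-1, j). It has `s`
edges to walk, while `f'` starts one step lower with one edge fewer, the surplus going into `t`.
Pythagoras splits the norm of `f`. -/
theorem HoroSystem.norm_proj_sq_le_sum (h : HoroSystem m q Y F) (n : ℕ) : ∀ {i j : ℤ} {s t : ℕ}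
    {f : Lp 𝕜 2 m}, n ≤ s → proj (h.le i j) f = f → proj (h.le (i - n) j) f = 0 →
    ‖proj (h.le (i - s) (j + s + t)) f‖ ^ 2 ≤
      (q : ℝ)⁻¹ ^ (s + 1 - n) * (∑ l ∈ Finset.range n, (q : ℝ)⁻¹ ^ l) * ‖f‖ ^ 2 := by
  induction n with
  | zero =>
    intro i j s t f _ hf h0
    rw [h.proj_index (show i - ((0 : ℕ) : ℤ) = i by simp) rfl, hf] at h0
    simp [h0]
  | succ n ih =>
    intro i j s t f hns hf h0
    obtain ⟨s, rfl⟩ : ∃ k, s = k + 1 := ⟨s - 1, by omega⟩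
    set f' := proj (h.le (i - 1) j) f with hf'
    have hp : proj (h.le i j) f' = f' := proj_proj_of_ge _ _ (h.F_mono (by omega) le_rfl) f
    have h1 := h.norm_proj_sq_le (s + 1) t (i := i) (j := j) (f := f - f')
      (by rw [map_sub, hf, hp]) (by rw [map_sub, hf', proj_proj, sub_self])
    have h2 := ih (i := i - 1) (j := j) (s := s) (t := t + 1) (f := f') (by omega)
      (proj_proj _ f) (by
        rw [hf', proj_proj_of_le _ _ (h.F_mono (by omega) le_rfl)]
        rw [h.proj_index (show i - 1 - (n : ℤ) = i - ((n + 1 : ℕ) : ℤ) by push_cast; ring) rfl]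
        exact h0)
    rw [h.proj_index (show i - 1 - (s : ℤ) = i - ((s + 1 : ℕ) : ℤ) by push_cast; ring)
      (show j + (s : ℤ) + ((t + 1 : ℕ) : ℤ) = j + ((s + 1 : ℕ) : ℤ) + t by push_cast; ring)] at h2
    have h3 : ‖proj (h.le (i - ((s + 1 : ℕ) : ℤ)) (j + ((s + 1 : ℕ) : ℤ) + t)) f‖ ^ 2 ≤
        (‖proj (h.le (i - ((s + 1 : ℕ) : ℤ)) (j + ((s + 1 : ℕ) : ℤ) + t)) (f - f')‖ +
          ‖proj (h.le (i - ((s + 1 : ℕ) : ℤ)) (j + ((s + 1 : ℕ) : ℤ) + t)) f'‖) ^ 2 := by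
      refine pow_le_pow_left₀ (norm_nonneg _) ?_ 2
      rw [map_sub]
      calc _ = _ := by rw [sub_add_cancel]
        _ ≤ _ := norm_add_le _ _
    refine h3.trans ?_
    -- The peeled difference supplies the last term of the geometric sum.
    rw [show (q : ℝ)⁻¹ ^ (s + 1) = (q : ℝ)⁻¹ ^ (s + 1 - n) * (q : ℝ)⁻¹ ^ n by
      rw [← pow_add]; congr 1; omega] at h1
    rw [norm_sq_eq_proj (h.le (i - 1) j) f, Finset.sum_range_succ, mul_add, ← hf',
      show s + 1 + 1 - (n + 1) = s + 1 - n by omega]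
    refine (add_sq_le_of_sq_le ?_ ?_ (sq_nonneg _) (sq_nonneg _) h1 h2).trans (le_of_eq ?_)
    · positivity
    · positivity
    · ring

/-- The factor 2 leaves room for a geometric sum of up to 4. For q ≥ 2 that sum is at most 2; for q
= 1 it is not bounded in `n`, but the claim then follows from contractivity. -/
theorem HoroSystem.norm_proj_le_two_mul (h : HoroSystem m q Y F) {i j : ℤ} {n s : ℕ} (hns : n ≤ s)
    (f : Lp 𝕜 2 m) (h0 : proj (h.le (i - n) j) f = 0) :
    ‖proj (h.le (i - s) (j + s)) (proj (h.le i j) f)‖ ≤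
      2 * (q : ℝ) ^ (-((s : ℝ) - (n : ℝ) + 1) / 2) * ‖proj (h.le i j) f‖ := by
  have hqR : (0 : ℝ) < q := by exact_mod_cast h.one_le
  rcases (show q = 1 ∨ 2 ≤ q by have := h.one_le; omega) with rfl | hq2
  · rw [Nat.cast_one, Real.one_rpow, mul_one]
    refine (norm_proj_le _ _).trans ?_
    linarith [norm_nonneg (proj (h.le i j) f)]
  have h1 := h.norm_proj_sq_le_sum n (t := 0) hns (proj_proj (h.le i j) f) (by
    rwa [proj_proj_of_le _ _ (h.F_mono (by omega) le_rfl)])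
  rw [h.proj_index rfl (show j + (s : ℤ) + ((0 : ℕ) : ℤ) = j + s by simp)] at h1
  have hr : (q : ℝ)⁻¹ ≤ 2⁻¹ := inv_anti₀ (by norm_num) (by exact_mod_cast hq2)
  have hsum : ∑ l ∈ Finset.range n, (q : ℝ)⁻¹ ^ l ≤ 4 := by
    have h2 : ∀ n : ℕ, ∑ l ∈ Finset.range n, (2⁻¹ : ℝ) ^ l ≤ 2 := fun n => by
      have : ∑ l ∈ Finset.range n, (2⁻¹ : ℝ) ^ l = 2 - 2 * 2⁻¹ ^ n := by
        induction n with
        | zero => simp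
        | succ n ih => rw [Finset.sum_range_succ, ih]; ring
      rw [this]
      have : (0 : ℝ) ≤ 2 * 2⁻¹ ^ n := by positivity
      linarith
    refine le_trans (Finset.sum_le_sum fun l _ => ?_) ((h2 n).trans (by norm_num))
    exact pow_le_pow_left₀ (by positivity) hr l
  refine le_of_sq_le_sq ?_ (by positivity)
  have hpow : ((q : ℝ) ^ (-((s : ℝ) - (n : ℝ) + 1) / 2)) ^ 2 = (q : ℝ)⁻¹ ^ (s + 1 - n) := by
    rw [← Real.rpow_natCast, ← Real.rpow_mul hqR.le, inv_pow, ← Real.rpow_natCast,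
      ← Real.rpow_neg hqR.le, Nat.cast_sub (by omega)]
    congr 1
    push_cast
    ring
  rw [mul_pow, mul_pow, hpow]
  refine h1.trans ?_
  refine mul_le_mul_of_nonneg_right ?_ (by positivity)
  rw [mul_comm]
  exact mul_le_mul_of_nonneg_right (hsum.trans (by norm_num)) (by positivity)

end System

end TriangleBuilding

/-! ### The proposition -/

theorem mainTheorem9 {𝕜 : Type*} [RCLike 𝕜] {V : Type*} (X : TypedComplex V)
    (hX : IsTriangleBuilding X) (q : ℕ) (hq : HasParameter X q) (b : Frame X)
    (m : MeasureTheory.Measure (Omega0 b)) (hm : IsBoundaryMeasure b q m)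
    (f : MeasureTheory.Lp 𝕜 2 m) (μ : Coweight) (j k : ℕ) (hjk : j ≤ k) :
    (condE b m (μ - (j : ℤ) • lam1) f = 0 →
      ‖condE b m (μ - (k : ℤ) • (lam1 - lam2)) (condE b m μ f)‖ ≤
        2 * (q : ℝ) ^ (-((k : ℝ) - (j : ℝ) + 1) / 2) * ‖condE b m μ f‖) ∧
    (condE b m (μ - (j : ℤ) • lam2) f = 0 →
      ‖condE b m (μ - (k : ℤ) • (lam2 - lam1)) (condE b m μ f)‖ ≤
        2 * (q : ℝ) ^ (-((k : ℝ) - (j : ℝ) + 1) / 2) * ‖condE b m μ f‖) := by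
  have h := horoSystem hX hq hm
  obtain ⟨x, y⟩ := μ
  have e1 : ((x, y) : Coweight) - (j : ℤ) • lam1 = (x - j, y) := by ext <;> simp [lam1]
  have e2 : ((x, y) : Coweight) - (j : ℤ) • lam2 = (x, y - j) := by ext <;> simp [lam2]
  have e3 : ((x, y) : Coweight) - (k : ℤ) • (lam1 - lam2) = (x - k, y + k) := by
    ext <;> simp [lam1, lam2]
  have e4 : ((x, y) : Coweight) - (k : ℤ) • (lam2 - lam1) = (x + k, y - k) := by
    ext <;> simp [lam1, lam2]
  rw [e1, e2, e3, e4]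
  -- `condE` is `proj` by definition, and exchanging the coordinates exchanges λ₁ and λ₂.
  exact ⟨fun h0 => h.norm_proj_le_two_mul hjk f h0, fun h0 => h.swap.norm_proj_le_two_mul hjk f h0⟩
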